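/- Consider the following random graph process (version 1). It starts with a single vertex. At each step two old vertices are chosen uniformly at random, independently of each other (possibly equal) and of the past. A new vertex is added and connected to the first chosen vertex and to all neighbours of that vertex; then all edges of the second chosen vertex are deleted, except that edges of the new vertex are kept. Thus the graph is simple and has $n+1$ vertices after $n$ steps. Let $X[n,d]$ be the number of vertices of degree $d$ after $n$ steps. The local clustering coefficient of a vertex of degree $d$ is the fraction of the $\binom d2$ pairs of its neighbours that are joined by an edge (and $0$ if $d<2$); the average (Watts–Strogatz) clustering coefficient of a graph is the average of the local clustering coefficients of all its vertices; the global clustering coefficient (transitivity) is $3$ times the number of triangles divided by the number of connected triplets (paths of length $2$). Theorem. There is a (deterministic) sequence $(c_d)_{d\ge 0}$ of positive numbers with $$c_0=\frac{1+c_1}{3},\qquad c_d=\frac{d+1}{2d+3}\,(c_{d-1}+c_{d+1})\quad(d\ge 1),$$ such that, almost surely as $n\to\infty$, $X[n,d]/(n+1)\to c_d$ for every $d\ge 0$, the global clustering coefficient of the graph after $n$ steps converges to $1$, and its average clustering coefficient converges to $1-c_0-c_1$. -/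

import Mathlib

open MeasureTheory ProbabilityTheory Filter Topology

/-- Duplication: a new vertex `Fin.last (n + 1)` is added to the graph `G` on the old vertices
`Fin (n + 1)` and joined to the old vertex `a` and to all neighbours of `a`. -/
def duplicate {n : ℕ} (G : SimpleGraph (Fin (n + 1))) (a : Fin (n + 1)) :
    SimpleGraph (Fin (n + 2)) :=
  G.map Fin.castSuccEmb ⊔
    SimpleGraph.fromEdgeSet
      {e | ∃ v : Fin (n + 1), (v = a ∨ G.Adj a v) ∧ e = s(v.castSucc, Fin.last (n + 1))}

/-- One step of version 1: duplicate the old vertex `a`, then delete all edges of the old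
vertex `b`, except that edges of the new vertex are kept. -/
def stepV1 {n : ℕ} (G : SimpleGraph (Fin (n + 1))) (a b : Fin (n + 1)) :
    SimpleGraph (Fin (n + 2)) :=
  (duplicate G a).deleteEdges {e | b.castSucc ∈ e ∧ Fin.last (n + 1) ∉ e}

/-- The version 1 graph after `n` steps, started from a single vertex: in the step leading from
`n + 1` to `n + 2` vertices, `a n` is duplicated and the edges of `b n` are erased. -/
def graphV1 (a b : (n : ℕ) → Fin (n + 1)) : (n : ℕ) → SimpleGraph (Fin (n + 1))
  | 0 => ⊥
  | n + 1 => stepV1 (graphV1 a b n) (a n) (b n)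

/-- The random choices driving the model: at each step two old vertices are chosen uniformly at
random, independently of each other and of the other steps. -/
structure IsUniformSelection {Ω : Type*} [MeasurableSpace Ω] (μ : Measure Ω)
    (A B : (n : ℕ) → Ω → Fin (n + 1)) : Prop where
  measurable_fst : ∀ n, Measurable (A n)
  measurable_snd : ∀ n, Measurable (B n)
  uniform_fst : ∀ n i, μ (A n ⁻¹' {i}) = ((n : ENNReal) + 1)⁻¹
  uniform_snd : ∀ n i, μ (B n ⁻¹' {i}) = ((n : ENNReal) + 1)⁻¹
  indep_pair : ∀ n, IndepFun (A n) (B n) μ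
  indep_steps : iIndepFun (fun n ω => (A n ω, B n ω)) μ

section Graph

open scoped Classical

/-- The number of vertices of degree `d`. -/
noncomputable def degreeCount {V : Type*} [Fintype V] (G : SimpleGraph V) (d : ℕ) : ℕ :=
  (Finset.univ.filter fun v => G.degree v = d).card

/-- The local clustering coefficient: the fraction of the pairs of neighbours of `v` that are
joined by an edge, and `0` if `v` has degree less than `2`. -/
noncomputable def localClustering {V : Type*} [Fintype V] (G : SimpleGraph V) (v : V) : ℝ :=
  if G.degree v < 2 then 0
  else ((G.induce (G.neighborSet v)).edgeFinset.card : ℝ) / ((G.degree v).choose 2 : ℝ)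

/-- The average (Watts–Strogatz) clustering coefficient. -/
noncomputable def averageClustering {V : Type*} [Fintype V] (G : SimpleGraph V) : ℝ :=
  (∑ v, localClustering G v) / (Fintype.card V : ℝ)

/-- The connected triplets (paths of length 2), each given by its central vertex and the
unordered pair of its two endpoints. -/
noncomputable def connectedTriplets {V : Type*} [Fintype V] (G : SimpleGraph V) :
    Finset ((_ : V) × Finset V) :=
  Finset.univ.sigma fun v => (G.neighborFinset v).powersetCard 2

/-- The global clustering coefficient (transitivity): three times the number of triangles divided
by the number of connected triplets. -/
noncomputable def globalClustering {V : Type*} [Fintype V] (G : SimpleGraph V) : ℝ :=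
  3 * ((G.cliqueFinset 3).card : ℝ) / ((connectedTriplets G).card : ℝ)

end Graph

/-! Degrees. If the effects of the two choices on a vertex are simply added, the average change of
the degree count `X d` is `((d+1) * (X (d-1) + X (d+1)) - (2d+2) * X d) / (n+1)`, plus `1` if `d =
0`. The true change can differ from this linearisation only at vertices in the closed neighbourhoods
of both chosen vertices (`abs_degreeCount_stepV1_sub_le`), and the average number of those is
`degreeSqSum G / (n+1)^2`. In the average change of `degreeSqSum` the quadratic terms cancel, so its
expectation is `O(n)`. After division by `n + 2`, the errors are therefore almost surely summable
and the martingale noise has summable variances.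

Hence the densities `X d / (n+1)` follow a stochastic approximation recursion for the infinite
linear system `limitDegree_balance`. A positive bounded solution is the Laplace transform at `1` of
a birth and death law, by its forward equations. Let `L d` be the limsup of the distance of the
`d`-th density from this solution. Then `L` is a bounded nonnegative subsolution of the homogeneous
system, hence nondecreasing and convex, hence zero (`tendsto_zero_of_coupled_recursion`).

Clustering. Duplicating `a` creates only copies of the open triplets through `a`, and erasing `b`
destroys those through `b`; on average these balance. The exceptions are triplets centred at the new
vertex that end at the erased vertex `b`, on average at most `2 * degreeSqSum G / (n+1)^2 = O(1/n)`
in expectation. So the expected number of open triplets is `O(log n)`, and an almost supermartingale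
argument makes their density vanish almost surely (`ae_tendsto_openCount`). Vertices of degree `2`
already give linearly many connected triplets, so transitivity tends to `1`; and the local
coefficient is `1` at all but `o(n)` vertices of degree at least `2`. -/

/-! ### The limiting degree distribution. -/

/-- The probability that a birth and death process started from `0`, with birth rates `d + 2` and
death rates `d`, is in state `d` at time `t`. -/
noncomputable def birthDeathLaw (d : ℕ) (t : ℝ) : ℝ := ((d : ℝ) + 1) * t ^ d / (1 + t) ^ (d + 2)

/-- The limiting degree distribution. -/
noncomputable def limitDegree (d : ℕ) : ℝ :=
  ∫ t in Set.Ioi (0 : ℝ), Real.exp (-t) * birthDeathLaw d t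

lemma birthDeathLaw_pos (d : ℕ) {t : ℝ} (ht : 0 < t) : 0 < birthDeathLaw d t := by
  unfold birthDeathLaw; positivity

lemma birthDeathLaw_le_one (d : ℕ) {t : ℝ} (ht : 0 < t) : birthDeathLaw d t ≤ 1 := by
  -- The two leading terms of the binomial expansion; the extra summand `t ^ (d + 1)` is what lets
  -- the induction close.
  have key : t ^ (d + 1) + ((d : ℝ) + 1) * t ^ d ≤ (1 + t) ^ (d + 1) := by
    induction d with
    | zero => simp [add_comm]
    | succ d ih =>
      have h1 := mul_le_mul_of_nonneg_right ih (by positivity : (0 : ℝ) ≤ 1 + t)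
      have h2 : 0 ≤ ((d : ℝ) + 1) * t ^ d := by positivity
      push_cast
      calc t ^ (d + 1 + 1) + ((d : ℝ) + 1 + 1) * t ^ (d + 1)
          ≤ (t ^ (d + 1) + ((d : ℝ) + 1) * t ^ d) * (1 + t) := by ring_nf at h2 ⊢; linarith
        _ ≤ _ := by rw [pow_succ (1 + t) (d + 1)]; exact h1
  have h1 : (1 + t) ^ (d + 1) ≤ (1 + t) ^ (d + 2) :=
    pow_le_pow_right₀ (by linarith) (by omega)
  have h2 : 0 ≤ t ^ (d + 1) := by positivity
  unfold birthDeathLaw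
  rw [div_le_one (by positivity)]
  linarith

lemma continuousOn_birthDeathLaw (d : ℕ) : ContinuousOn (birthDeathLaw d) (Set.Ici 0) := by
  unfold birthDeathLaw
  refine ContinuousOn.div (by fun_prop) (by fun_prop) fun t ht => ?_
  have : (0 : ℝ) ≤ t := ht
  positivity

lemma integrableOn_exp_mul_birthDeathLaw (d : ℕ) :
    IntegrableOn (fun t : ℝ => Real.exp (-t) * birthDeathLaw d t) (Set.Ioi 0) := by
  refine Integrable.mono' (integrableOn_exp_neg_Ioi 0) ?_ ?_
  · refine ContinuousOn.aestronglyMeasurable ?_ measurableSet_Ioi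
    exact (by fun_prop : Continuous fun t : ℝ => Real.exp (-t)).continuousOn.mul
      ((continuousOn_birthDeathLaw d).mono Set.Ioi_subset_Ici_self)
  · refine (ae_restrict_iff' measurableSet_Ioi).2 (ae_of_all _ fun t ht => ?_)
    have h0 := birthDeathLaw_pos d ht
    rw [Real.norm_of_nonneg (by positivity)]
    exact mul_le_of_le_one_right (Real.exp_pos _).le (birthDeathLaw_le_one d ht)

lemma limitDegree_pos (d : ℕ) : 0 < limitDegree d := by
  unfold limitDegree
  rw [setIntegral_pos_iff_support_of_nonneg_ae _ (integrableOn_exp_mul_birthDeathLaw d)]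
  · have : Set.Ioi (0 : ℝ) ⊆ (Function.support fun t : ℝ => Real.exp (-t) * birthDeathLaw d t) ∩
        Set.Ioi 0 := fun t ht =>
      ⟨(mul_pos (Real.exp_pos _) (birthDeathLaw_pos d ht)).ne', ht⟩
    exact lt_of_lt_of_le (by simp) (measure_mono this)
  · refine (ae_restrict_iff' measurableSet_Ioi).2 (ae_of_all _ fun t ht => ?_)
    exact (mul_pos (Real.exp_pos _) (birthDeathLaw_pos d ht)).le

lemma limitDegree_le_one (d : ℕ) : limitDegree d ≤ 1 := by
  have h := setIntegral_mono_on (integrableOn_exp_mul_birthDeathLaw d) (integrableOn_exp_neg_Ioi 0)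
    measurableSet_Ioi fun t ht =>
      mul_le_of_le_one_right (Real.exp_pos (-t)).le (birthDeathLaw_le_one d ht)
  rwa [integral_exp_neg_Ioi_zero] at h

lemma hasDerivAt_birthDeathLaw (d : ℕ) {t : ℝ} (ht : 0 ≤ t) :
    HasDerivAt (birthDeathLaw d) (((d : ℝ) + 1) * (d * t ^ (d - 1) * (1 + t) ^ (d + 2)
      - t ^ d * ((d + 2) * (1 + t) ^ (d + 1))) / ((1 + t) ^ (d + 2)) ^ 2) t := by
  have h := (((hasDerivAt_id t).pow d).const_mul ((d : ℝ) + 1)).div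
    (((hasDerivAt_id t).const_add 1).pow (d + 2)) (by simp; positivity)
  refine HasDerivAt.congr_deriv (f := birthDeathLaw d) h ?_
  simp only [id_eq, mul_one, Pi.pow_apply, Nat.add_one_sub_one, Nat.cast_add, Nat.cast_ofNat]
  ring

lemma hasDerivAt_birthDeathLaw_zero {t : ℝ} (ht : 0 ≤ t) :
    HasDerivAt (birthDeathLaw 0) (birthDeathLaw 1 t - 2 * birthDeathLaw 0 t) t := by
  have h0 : (1 + t) ≠ 0 := by positivity
  refine (hasDerivAt_birthDeathLaw 0 ht).congr_deriv ?_
  simp [birthDeathLaw]; field_simp; ring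

/-- Forward equation: state `d + 1` is entered from `d` and from `d + 2`, both at rate `d + 2`, and
left at rate `(d + 3) + (d + 1)`. -/
lemma hasDerivAt_birthDeathLaw_succ (d : ℕ) {t : ℝ} (ht : 0 ≤ t) :
    HasDerivAt (birthDeathLaw (d + 1))
      (((d : ℝ) + 2) * (birthDeathLaw d t + birthDeathLaw (d + 2) t)
        - (2 * d + 4) * birthDeathLaw (d + 1) t) t := by
  have h0 : (1 + t) ≠ 0 := by positivity
  refine (hasDerivAt_birthDeathLaw (d + 1) ht).congr_deriv ?_
  simp [birthDeathLaw]; field_simp; ring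

/-- Integration by parts against `exp (-t)`. -/
lemma limitDegree_eq_of_hasDerivAt (d : ℕ) {g : ℝ → ℝ}
    (hg : IntegrableOn (fun t => Real.exp (-t) * g t) (Set.Ioi 0))
    (hd : ∀ t, 0 ≤ t → HasDerivAt (birthDeathLaw d) (g t) t) :
    limitDegree d = birthDeathLaw d 0 + ∫ t in Set.Ioi (0 : ℝ), Real.exp (-t) * g t := by
  have hderiv : ∀ t ∈ Set.Ici (0 : ℝ), HasDerivAt (fun t => -(Real.exp (-t) * birthDeathLaw d t))
      (Real.exp (-t) * birthDeathLaw d t - Real.exp (-t) * g t) t := fun t ht => by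
    have h1 : HasDerivAt (fun t : ℝ => Real.exp (-t)) (-Real.exp (-t)) t := by
      simpa using (hasDerivAt_neg t).exp
    exact (h1.mul (hd t ht)).neg.congr_deriv (by ring)
  have hlim : Tendsto (fun t => -(Real.exp (-t) * birthDeathLaw d t)) atTop (𝓝 0) := by
    rw [← neg_zero]
    refine Tendsto.neg (squeeze_zero' ?_ ?_ Real.tendsto_exp_neg_atTop_nhds_zero)
    · filter_upwards [eventually_gt_atTop 0] with t ht
      exact (mul_pos (Real.exp_pos _) (birthDeathLaw_pos d ht)).le
    · filter_upwards [eventually_gt_atTop 0] with t ht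
      exact mul_le_of_le_one_right (Real.exp_pos _).le (birthDeathLaw_le_one d ht)
  have h := integral_Ioi_of_hasDerivAt_of_tendsto' hderiv
    ((integrableOn_exp_mul_birthDeathLaw d).sub hg) hlim
  rw [integral_sub (integrableOn_exp_mul_birthDeathLaw d) hg] at h
  simp only [neg_zero, Real.exp_zero, one_mul, sub_neg_eq_add, zero_add] at h
  unfold limitDegree
  linarith

/-- The weight `exp (-t)` raises the exit rate `2` to `3`, and the constant `1` is the initial mass
at state `0`. For higher states the initial mass is zero, so the recursion is homogeneous there. -/
lemma limitDegree_zero : 3 * limitDegree 0 = 1 + limitDegree 1 := by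
  have i0 := integrableOn_exp_mul_birthDeathLaw 0
  have i1 := integrableOn_exp_mul_birthDeathLaw 1
  have e : (fun t => Real.exp (-t) * (birthDeathLaw 1 t - 2 * birthDeathLaw 0 t)) =
      fun t => Real.exp (-t) * birthDeathLaw 1 t - 2 * (Real.exp (-t) * birthDeathLaw 0 t) := by
    ext t; ring
  have h := limitDegree_eq_of_hasDerivAt 0 (by rw [e]; exact i1.sub (i0.const_mul 2))
    fun t ht => hasDerivAt_birthDeathLaw_zero ht
  rw [e, integral_sub i1 (i0.const_mul 2), integral_const_mul] at h
  have h0 : birthDeathLaw 0 0 = 1 := by simp [birthDeathLaw]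
  rw [h0] at h
  unfold limitDegree at *
  linarith

lemma limitDegree_succ (d : ℕ) : (2 * (d : ℝ) + 5) * limitDegree (d + 1) =
    ((d : ℝ) + 2) * (limitDegree d + limitDegree (d + 2)) := by
  have i0 := integrableOn_exp_mul_birthDeathLaw d
  have i1 := integrableOn_exp_mul_birthDeathLaw (d + 1)
  have i2 := integrableOn_exp_mul_birthDeathLaw (d + 2)
  have e : (fun t => Real.exp (-t) * (((d : ℝ) + 2) * (birthDeathLaw d t + birthDeathLaw (d + 2) t)
        - (2 * d + 4) * birthDeathLaw (d + 1) t)) =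
      fun t => ((d : ℝ) + 2) * (Real.exp (-t) * birthDeathLaw d t +
        Real.exp (-t) * birthDeathLaw (d + 2) t) -
          (2 * d + 4) * (Real.exp (-t) * birthDeathLaw (d + 1) t) := by
    ext t; ring
  have j : IntegrableOn (fun t => ((d : ℝ) + 2) * (Real.exp (-t) * birthDeathLaw d t +
      Real.exp (-t) * birthDeathLaw (d + 2) t)) (Set.Ioi 0) := (i0.add i2).const_mul ((d : ℝ) + 2)
  have h := limitDegree_eq_of_hasDerivAt (d + 1)
    (by rw [e]; exact j.sub (i1.const_mul (2 * (d : ℝ) + 4)))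
    fun t ht => hasDerivAt_birthDeathLaw_succ d ht
  rw [e, integral_sub j (i1.const_mul _), integral_const_mul, integral_const_mul,
    integral_add i0 i2] at h
  have h0 : birthDeathLaw (d + 1) 0 = 0 := by simp [birthDeathLaw]
  rw [h0] at h
  unfold limitDegree at *
  linarith

/-- The recursion of the limiting degree distribution, as a balance equation. -/
lemma limitDegree_balance (d : ℕ) : (2 * (d : ℝ) + 3) * limitDegree d =
    ((d : ℝ) + 1) * ((if d = 0 then 0 else limitDegree (d - 1)) + limitDegree (d + 1)) +
      if d = 0 then 1 else 0 := by
  cases d with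
  | zero => simpa [add_comm] using limitDegree_zero
  | succ d =>
    have := limitDegree_succ d
    push_cast
    linear_combination this

/-! ### Deterministic tools: uniqueness, and stochastic approximation in dimension one. -/

/-- A bounded nonnegative subsolution of the balance equation vanishes. -/
lemma eq_zero_of_bounded_subsolution {D : ℕ → ℝ} {K : ℝ} (h0 : ∀ d, 0 ≤ D d) (hK : ∀ d, D d ≤ K)
    (hD : ∀ d : ℕ, (2 * (d : ℝ) + 3) * D d ≤
      ((d : ℝ) + 1) * ((if d = 0 then 0 else D (d - 1)) + D (d + 1))) (d : ℕ) : D d = 0 := by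
  -- The inequality at `d + 1`, divided by `d + 2`: the increments are nonnegative and grow by at
  -- least `D (d + 1) / (d + 2)`.
  have hinc : ∀ d, 0 ≤ D (d + 1) - D d ∧
      D (d + 1) - D d + D (d + 1) / (d + 2) ≤ D (d + 2) - D (d + 1) := by
    have step : ∀ d : ℕ, D (d + 1) - D d + D (d + 1) / (d + 2) ≤ D (d + 2) - D (d + 1) := by
      intro d
      have h := hD (d + 1)
      rw [if_neg (by omega), add_tsub_cancel_right] at h
      push_cast at h
      have h2 : (0 : ℝ) < d + 2 := by positivity
      have h3 : D (d + 1) / (d + 2) * (d + 2) = D (d + 1) := by field_simp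
      refine le_of_mul_le_mul_right ?_ h2
      rw [add_mul, h3]
      linarith
    intro d
    refine ⟨?_, step d⟩
    induction d with
    | zero => have := hD 0; simp at this; have := h0 0; simp; linarith
    | succ d ih =>
      have := step d
      have h1 : 0 ≤ D (d + 1) / (d + 2) := div_nonneg (h0 _) (by positivity)
      show 0 ≤ D (d + 2) - D (d + 1)
      linarith
  have hmono : ∀ k m, D (k + 1) - D k ≤ D (k + m + 1) - D (k + m) := by
    intro k m
    induction m with
    | zero => simp
    | succ m ih =>
      have h1 : 0 ≤ D (k + m + 1) / ((k + m : ℕ) + 2) := div_nonneg (h0 _) (by positivity)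
      have h2 := (hinc (k + m)).2
      show D (k + 1) - D k ≤ D (k + m + 2) - D (k + m + 1)
      linarith
  have hlin : ∀ k (m : ℕ), m * (D (k + 1) - D k) ≤ D (k + m) := by
    intro k m
    induction m with
    | zero => simpa using h0 k
    | succ m ih =>
      have := hmono k m
      push_cast
      rw [← add_assoc]
      linarith
  -- A positive increment would force linear growth by convexity, against the bound `K`. Constancy
  -- then kills the extra term `D (d + 1) / (d + 2)`.
  have hflat : ∀ k, D (k + 1) - D k ≤ 0 := by
    intro k
    by_contra! hpos
    obtain ⟨m, hm⟩ := exists_nat_gt (K / (D (k + 1) - D k))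
    rw [div_lt_iff₀ hpos] at hm
    linarith [hlin k m, hK (k + m)]
  cases d with
  | zero => have := hD 0; simp at this; have := h0 0; have := hflat 0; simp at this; linarith
  | succ d =>
    have h1 := (hinc d).2
    have h2 := hflat (d + 1)
    have h3 := (hinc d).1
    have h4 : 0 ≤ D (d + 1) / (d + 2) := div_nonneg (h0 _) (by positivity)
    have h5 : D (d + 1) / (d + 2) = 0 := le_antisymm (by
      have : D (d + 1 + 1) = D (d + 2) := rfl
      linarith) h4
    rcases div_eq_zero_iff.1 h5 with h | h
    · exact h
    · have : (0 : ℝ) < d + 2 := by positivity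
      linarith

/-- If `w` is contracted by the factors `(n + 1) / (n + 2)` towards `η`, it is eventually
at most slightly above `η`. -/
lemma eventually_le_of_contract {w : ℕ → ℝ} {κ η : ℝ} (hκ : 1 ≤ κ)
    (h : ∀ᶠ n : ℕ in atTop, w (n + 1) ≤ (1 - κ / (n + 2)) * w n + κ / (n + 2) * η) {ε : ℝ}
    (hε : 0 < ε) : ∀ᶠ n in atTop, w n ≤ η + ε := by
  obtain ⟨m, hm⟩ := eventually_atTop.1 (h.and (tendsto_natCast_atTop_atTop.eventually_ge_atTop κ))
  -- From `m` on, `p n * (n + 1)` does not increase, so this excess is `O(1/n)`.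
  set p : ℕ → ℝ := fun n => max (w n - η) 0 with hp
  have hstep : ∀ n, m ≤ n → p (n + 1) * (n + 2) ≤ p n * (n + 1) := by
    intro n hn
    obtain ⟨h1, h2⟩ := hm n hn
    have hn2 : (0 : ℝ) < n + 2 := by positivity
    have h3 : 0 ≤ 1 - κ / ((n : ℝ) + 2) := by
      rw [sub_nonneg, div_le_one hn2]; linarith
    have h4 : p (n + 1) ≤ (1 - κ / (n + 2)) * p n := by
      refine max_le ?_ (mul_nonneg h3 (le_max_right _ _))
      have := mul_le_mul_of_nonneg_left (le_max_left (w n - η) 0) h3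
      rw [hp]; dsimp only
      linarith
    have h5 : 1 - κ / ((n : ℝ) + 2) ≤ (n + 1) / (n + 2) := by
      rw [le_div_iff₀ hn2, sub_mul, div_mul_cancel₀ _ hn2.ne']; linarith
    have h6 : p (n + 1) ≤ (n + 1) / (n + 2) * p n :=
      h4.trans (mul_le_mul_of_nonneg_right h5 (le_max_right _ _))
    calc p (n + 1) * (n + 2) ≤ (n + 1) / (n + 2) * p n * (n + 2) := by gcongr
      _ = p n * (n + 1) := by field_simp
  have hall : ∀ n, m ≤ n → p n * (n + 1) ≤ p m * (m + 1) := by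
    intro n hn
    induction n, hn using Nat.le_induction with
    | base => exact le_rfl
    | succ n hn ih =>
      refine le_trans (le_of_eq ?_) ((hstep n hn).trans ih)
      push_cast; ring
  filter_upwards [eventually_ge_atTop m,
    tendsto_natCast_atTop_atTop.eventually_ge_atTop (p m * (m + 1) / ε)] with n hn h1
  have h2 := hall n hn
  rw [div_le_iff₀ hε] at h1
  have h3 : p n ≤ ε := by
    by_contra! hlt
    have : ε * (n + 1) < p n * (n + 1) := by gcongr
    linarith
  have := (le_max_left (w n - η) 0).trans h3
  linarith

/-- A deterministic stochastic approximation lemma in dimension one. -/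
lemma eventually_abs_le_of_recursion {y g e : ℕ → ℝ} {κ γ l : ℝ} (hκ : 1 ≤ κ)
    (hy : ∀ n : ℕ, y (n + 1) = y n + (g n - κ * y n) / (n + 2) + e n)
    (he : Tendsto (fun n => ∑ k ∈ Finset.range n, e k) atTop (𝓝 l))
    (hg : ∀ ε > 0, ∀ᶠ n in atTop, |g n| ≤ γ + ε) {ε : ℝ} (hε : 0 < ε) :
    ∀ᶠ n in atTop, |y n| ≤ γ / κ + ε := by
  have hκ0 : 0 < κ := by linarith
  -- Adding the tail of the noise series absorbs the noise: `y + τ` obeys the noiseless recursion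
  -- with `g` replaced by `g + κ * τ`, and `τ` tends to zero.
  set τ : ℕ → ℝ := fun n => l - ∑ k ∈ Finset.range n, e k with hτ
  have hτ0 : Tendsto τ atTop (𝓝 0) := by simpa using he.const_sub l
  have hτs : ∀ δ > 0, ∀ᶠ n in atTop, |τ n| ≤ δ := fun δ hδ => by
    filter_upwards [(tendsto_order.1 hτ0.abs).2 δ (by simpa using hδ)] with n hn using hn.le
  have hz : ∀ᶠ n : ℕ in atTop, |y (n + 1) + τ (n + 1)| ≤
      (1 - κ / (n + 2)) * |y n + τ n| + κ / (n + 2) * (γ / κ + ε / 3) := by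
    filter_upwards [hg (κ * (ε / 6)) (by positivity), hτs (ε / 6) (by positivity),
      tendsto_natCast_atTop_atTop.eventually_ge_atTop κ] with n h1 h2 h3
    have hn2 : (0 : ℝ) < n + 2 := by positivity
    have h4 : 0 ≤ 1 - κ / ((n : ℝ) + 2) := by
      rw [sub_nonneg, div_le_one hn2]; linarith
    have h5 : y (n + 1) + τ (n + 1) =
        (1 - κ / (n + 2)) * (y n + τ n) + (g n + κ * τ n) / (n + 2) := by
      rw [hy, hτ]; simp only [Finset.sum_range_succ]; field_simp; ring
    have h6 : |g n + κ * τ n| ≤ κ * (γ / κ + ε / 3) := by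
      calc |g n + κ * τ n| ≤ |g n| + |κ * τ n| := abs_add_le _ _
        _ ≤ (γ + κ * (ε / 6)) + κ * (ε / 6) := by
          rw [abs_mul, abs_of_pos hκ0]; gcongr
        _ = _ := by field_simp; ring
    calc |y (n + 1) + τ (n + 1)|
        ≤ |(1 - κ / (n + 2)) * (y n + τ n)| + |(g n + κ * τ n) / (n + 2)| := by
          rw [h5]; exact abs_add_le _ _
      _ ≤ (1 - κ / (n + 2)) * |y n + τ n| + κ * (γ / κ + ε / 3) / (n + 2) := by
          rw [abs_mul, abs_of_nonneg h4, abs_div, abs_of_pos hn2]; gcongr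
      _ = _ := by ring
  filter_upwards [eventually_le_of_contract (w := fun n => |y n + τ n|) hκ hz
    (by positivity : 0 < ε / 3), hτs (ε / 3) (by positivity)] with n h1 h2
  have h3 : |y n| ≤ |y n + τ n| + |τ n| := by
    calc |y n| = |(y n + τ n) - τ n| := by ring_nf
      _ ≤ _ := abs_sub _ _
  linarith

/-! ### Adjacency and degrees after one step. -/

section Step

open scoped Classical

variable {n : ℕ} (G : SimpleGraph (Fin (n + 1))) (a b v w : Fin (n + 1))

lemma stepV1_adj_castSucc : (stepV1 G a b).Adj v.castSucc w.castSucc ↔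
    G.Adj v w ∧ v ≠ b ∧ w ≠ b := by
  have h1 : ∀ x : Fin (n + 1), Fin.last (n + 1) ≠ x.castSucc := fun x => (Fin.castSucc_ne_last x).symm
  have h2 : (duplicate G a).Adj v.castSucc w.castSucc ↔ G.Adj v w := by
    simp only [duplicate, SimpleGraph.sup_adj, SimpleGraph.fromEdgeSet_adj]
    constructor
    · rintro (h | ⟨⟨x, -, hx⟩, -⟩)
      · exact (SimpleGraph.map_adj_apply (f := Fin.castSuccEmb) (a := v) (b := w)).1 h
      · simp [(h1 _).symm] at hx
    · exact fun h => Or.inl ((SimpleGraph.map_adj_apply (f := Fin.castSuccEmb)).2 h)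
  rw [stepV1, SimpleGraph.deleteEdges_adj, h2]
  simp only [Set.mem_ofPred_eq, Sym2.mem_iff, Fin.castSucc_inj, h1, or_self, not_false_eq_true,
    and_true, not_or, ne_eq, eq_comm (a := b)]

/-- The vertex `b` plays no role here, because erasure spares the edges of the new vertex. -/
lemma stepV1_adj_last : (stepV1 G a b).Adj (Fin.last (n + 1)) w.castSucc ↔
    w = a ∨ G.Adj a w := by
  have h1 : ∀ x : Fin (n + 1), Fin.last (n + 1) ≠ x.castSucc := fun x => (Fin.castSucc_ne_last x).symm
  have h2 : (duplicate G a).Adj (Fin.last (n + 1)) w.castSucc ↔ w = a ∨ G.Adj a w := by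
    simp only [duplicate, SimpleGraph.sup_adj, SimpleGraph.fromEdgeSet_adj]
    constructor
    · rintro (h | ⟨⟨x, hx, hx'⟩, -⟩)
      · obtain ⟨x, y, -, hx, -⟩ := (SimpleGraph.map_adj _ _ _ _).1 h
        exact absurd hx.symm (h1 x)
      · have : w = x := by simpa [h1, (h1 _).symm] using hx'
        rwa [this]
    · exact fun h => Or.inr ⟨⟨w, h, Sym2.eq_swap⟩, h1 w⟩
  rw [stepV1, SimpleGraph.deleteEdges_adj, h2]
  simp

lemma stepV1_adj_last' : (stepV1 G a b).Adj w.castSucc (Fin.last (n + 1)) ↔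
    w = a ∨ G.Adj a w := by
  rw [SimpleGraph.adj_comm, stepV1_adj_last]

/-- The indicator of adjacency. -/
noncomputable def nbInd {V : Type*} (G : SimpleGraph V) (v w : V) : ℝ := if G.Adj v w then 1 else 0

/-- The indicator of the closed neighbourhood. -/
noncomputable def clInd {V : Type*} (G : SimpleGraph V) (v w : V) : ℝ :=
  if w = v ∨ G.Adj v w then 1 else 0

lemma nbInd_comm {V : Type*} (G : SimpleGraph V) (v w : V) : nbInd G v w = nbInd G w v := by
  simp only [nbInd, G.adj_comm]

lemma clInd_comm {V : Type*} (G : SimpleGraph V) (v w : V) : clInd G v w = clInd G w v := by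
  simp only [clInd, G.adj_comm, eq_comm]

lemma nbInd_nonneg {V : Type*} (G : SimpleGraph V) (v w : V) : 0 ≤ nbInd G v w := by
  unfold nbInd; split_ifs <;> norm_num

lemma clInd_nonneg {V : Type*} (G : SimpleGraph V) (v w : V) : 0 ≤ clInd G v w := by
  unfold clInd; split_ifs <;> norm_num

lemma sum_nbInd {V : Type*} [Fintype V] (G : SimpleGraph V) (v : V) :
    ∑ w, nbInd G v w = G.degree v := by
  simp only [nbInd, Finset.sum_boole, ← SimpleGraph.card_neighborFinset_eq_degree,
    SimpleGraph.neighborFinset_eq_filter]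

lemma clInd_eq {V : Type*} (G : SimpleGraph V) (v w : V) :
    clInd G v w = nbInd G v w + if w = v then 1 else 0 := by
  unfold clInd nbInd
  by_cases h : w = v
  · subst h; simp
  · simp [h]

lemma sum_clInd {V : Type*} [Fintype V] (G : SimpleGraph V) (v : V) :
    ∑ w, clInd G v w = G.degree v + 1 := by
  simp [clInd_eq, Finset.sum_add_distrib, sum_nbInd]

lemma sum_clInd' {V : Type*} [Fintype V] (G : SimpleGraph V) (v : V) :
    ∑ w, clInd G w v = G.degree v + 1 := by
  simp_rw [clInd_comm G _ v, sum_clInd]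

lemma sum_nbInd' {V : Type*} [Fintype V] (G : SimpleGraph V) (v : V) :
    ∑ w, nbInd G w v = G.degree v := by
  simp_rw [nbInd_comm G _ v, sum_nbInd]

lemma degree_stepV1_last :
    ((stepV1 G a b).degree (Fin.last (n + 1)) : ℝ) = G.degree a + 1 := by
  rw [← sum_nbInd, Fin.sum_univ_castSucc, ← sum_clInd]
  simp only [nbInd, clInd, stepV1_adj_last, SimpleGraph.irrefl, if_false, add_zero]
  refine Finset.sum_congr rfl fun w _ => ?_
  congr

/-- The gain `clInd` is the edge to the new vertex, which survives even if `v = b`. The two losses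
never overlap, since `nbInd G b b = 0`. -/
lemma degree_stepV1_castSucc : ((stepV1 G a b).degree v.castSucc : ℝ) =
    G.degree v + clInd G v a - nbInd G v b - if v = b then (G.degree v : ℝ) else 0 := by
  rw [← sum_nbInd, Fin.sum_univ_castSucc]
  have h1 : nbInd (stepV1 G a b) v.castSucc (Fin.last (n + 1)) = clInd G v a := by
    simp [nbInd, clInd, stepV1_adj_last', G.adj_comm, eq_comm]
  have h2 : ∀ w, nbInd (stepV1 G a b) v.castSucc w.castSucc =
      nbInd G v w - (if w = b then nbInd G v b else 0) - if v = b then nbInd G v w else 0 := by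
    intro w
    by_cases hv : v = b <;> by_cases hw : w = b <;> simp [nbInd, stepV1_adj_castSucc, hv, hw]
  rw [h1]
  simp only [h2, Finset.sum_sub_distrib, Finset.sum_ite_eq', Finset.mem_univ, if_true]
  split_ifs with h
  · rw [sum_nbInd]; ring
  · rw [sum_nbInd, Finset.sum_const_zero]; ring

/-! ### Average growth of the first two degree moments. -/

/-- The average over the two uniform choices. -/
noncomputable def selectAvg {n : ℕ} (f : Fin (n + 1) → Fin (n + 1) → ℝ) : ℝ :=
  (∑ a, ∑ b, f a b) / ((n : ℝ) + 1) ^ 2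

lemma selectAvg_mono {f g : Fin (n + 1) → Fin (n + 1) → ℝ} (h : ∀ a b, f a b ≤ g a b) :
    selectAvg f ≤ selectAvg g := by
  unfold selectAvg
  gcongr with a _ b _
  exact h a b

/-- The sum of the degrees. -/
noncomputable def degreeSum {V : Type*} [Fintype V] (G : SimpleGraph V) : ℝ :=
  ∑ v, (G.degree v : ℝ)

/-- The sum of the squared sizes of the closed neighbourhoods. -/
noncomputable def degreeSqSum {V : Type*} [Fintype V] (G : SimpleGraph V) : ℝ :=
  ∑ v, ((G.degree v : ℝ) + 1) ^ 2

lemma degreeSqSum_nonneg {V : Type*} [Fintype V] (G : SimpleGraph V) : 0 ≤ degreeSqSum G :=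
  Finset.sum_nonneg fun _ _ => by positivity

lemma degreeSum_bot {V : Type*} [Fintype V] : degreeSum (⊥ : SimpleGraph V) = 0 := by
  simp_rw [degreeSum, ← sum_nbInd]
  simp [nbInd]

lemma degreeSqSum_bot {V : Type*} [Fintype V] :
    degreeSqSum (⊥ : SimpleGraph V) = Fintype.card V := by
  simp_rw [degreeSqSum, ← sum_nbInd]
  simp [nbInd]

/-- A sum over both choices of a function that is affine in the neighbourhood indicators. -/
lemma sum_sum_affine (p q r s t : Fin (n + 1) → ℝ) :
    ∑ a, ∑ b, (∑ v, (p v + clInd G v a * q v + nbInd G v b * r v + if v = b then s v else 0)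
      + t a) =
    (n + 1) * ∑ v, ((n + 1) * p v + (G.degree v + 1) * q v + G.degree v * r v + s v + t v) := by
  have h1 : ∀ a b, (∑ v, (p v + clInd G v a * q v + nbInd G v b * r v + if v = b then s v else 0)
      + t a) = ∑ v, p v + (∑ v, clInd G v a * q v + t a) + (∑ v, nbInd G v b * r v + s b) := by
    intro a b
    simp only [Finset.sum_add_distrib, Finset.sum_ite_eq', Finset.mem_univ, if_true]
    ring
  have h2 : ∑ a, ∑ v, clInd G v a * q v = ∑ v, ((G.degree v : ℝ) + 1) * q v := by
    rw [Finset.sum_comm]; simp_rw [← Finset.sum_mul, sum_clInd]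
  have h3 : ∑ a, ∑ v, nbInd G v a * r v = ∑ v, (G.degree v : ℝ) * r v := by
    rw [Finset.sum_comm]; simp_rw [← Finset.sum_mul, sum_nbInd]
  simp_rw [h1]
  simp only [Finset.sum_add_distrib, Finset.sum_const, Finset.card_univ, Fintype.card_fin,
    nsmul_eq_mul, h2, h3, ← Finset.mul_sum]
  push_cast
  ring

/-- Duplication adds `2 * (deg a + 1)` and erasure removes `2 * deg b`, apart from the interaction
with the new edges, which are kept; averaging leaves `2`. -/
lemma selectAvg_degreeSum :
    selectAvg (fun a b => degreeSum (stepV1 G a b)) = degreeSum G + 2 := by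
  have h : ∀ a b, degreeSum (stepV1 G a b) =
      ∑ v, ((G.degree v : ℝ) + clInd G v a * 1 + nbInd G v b * (-1) +
        if v = b then -(G.degree v : ℝ) else 0) + ((G.degree a : ℝ) + 1) := by
    intro a b
    rw [degreeSum, Fin.sum_univ_castSucc, degree_stepV1_last]
    congr 1
    refine Finset.sum_congr rfl fun v _ => ?_
    rw [degree_stepV1_castSucc]
    split_ifs <;> ring
  have hn : ((n : ℝ) + 1) ≠ 0 := by positivity
  unfold selectAvg
  simp_rw [h]
  rw [sum_sum_affine, div_eq_iff (by positivity)]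
  have : ∀ v, ((n : ℝ) + 1) * (G.degree v : ℝ) + (G.degree v + 1) * 1 + G.degree v * (-1) +
      -(G.degree v : ℝ) + (G.degree v + 1) = ((n : ℝ) + 1) * G.degree v + 2 := fun v => by ring
  simp_rw [this]
  rw [Finset.sum_add_distrib, ← Finset.mul_sum]
  simp [degreeSum]
  ring

/-- The quadratic contributions of growth, loss, erasure and the new vertex cancel, leaving `6 * deg
v + 7` per vertex before averaging. This cancellation keeps the second moment linear in `n`. -/
lemma selectAvg_degreeSqSum_le : selectAvg (fun a b => degreeSqSum (stepV1 G a b)) ≤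
    degreeSqSum G + 6 * degreeSum G / (n + 1) + 7 := by
  -- The effects of the two choices are added as if they did not interact; where both hit the same
  -- vertex, this only overestimates.
  have h : ∀ a b, degreeSqSum (stepV1 G a b) ≤
      ∑ v, (((G.degree v : ℝ) + 1) ^ 2 + clInd G v a * (2 * G.degree v + 3) +
        nbInd G v b * (-(2 * G.degree v + 1)) +
        if v = b then 1 - ((G.degree v : ℝ) + 1) ^ 2 else 0) + ((G.degree a : ℝ) + 2) ^ 2 := by
    intro a b
    rw [degreeSqSum, Fin.sum_univ_castSucc, degree_stepV1_last]
    refine add_le_add (Finset.sum_le_sum fun v _ => ?_) (le_of_eq (by ring))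
    rw [degree_stepV1_castSucc]
    have hd : (0 : ℝ) ≤ G.degree v := by positivity
    by_cases hv : v = b
    · subst hv
      by_cases h1 : a = v ∨ G.Adj v a <;> simp [clInd, nbInd, h1]; nlinarith
    · by_cases h1 : a = v ∨ G.Adj v a <;> by_cases h2 : G.Adj v b <;>
        simp [clInd, nbInd, h1, h2, hv] <;> nlinarith
  have hn : ((n : ℝ) + 1) ≠ 0 := by positivity
  refine (selectAvg_mono h).trans (le_of_eq ?_)
  unfold selectAvg
  rw [sum_sum_affine, div_eq_iff (by positivity)]
  have : ∀ v, ((n : ℝ) + 1) * ((G.degree v : ℝ) + 1) ^ 2 +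
      (G.degree v + 1) * (2 * (G.degree v : ℝ) + 3) + G.degree v * (-(2 * (G.degree v : ℝ) + 1)) +
      (1 - ((G.degree v : ℝ) + 1) ^ 2) + ((G.degree v : ℝ) + 2) ^ 2 =
      ((n : ℝ) + 1) * ((G.degree v : ℝ) + 1) ^ 2 + 6 * G.degree v + 7 := fun v => by ring
  simp_rw [this]
  rw [Finset.sum_add_distrib, Finset.sum_add_distrib, ← Finset.mul_sum, ← Finset.mul_sum]
  simp [degreeSum, degreeSqSum]
  field_simp

/-! ### Open triplets in one step. -/

/-- The indicator of an ordered open triplet with centre `v` and endpoints `x`, `y`. -/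
noncomputable def openInd {V : Type*} (G : SimpleGraph V) (x v y : V) : ℝ :=
  if G.Adj v x ∧ G.Adj v y ∧ x ≠ y ∧ ¬ G.Adj x y then 1 else 0

/-- The number of ordered open triplets. -/
noncomputable def openCount {V : Type*} [Fintype V] (G : SimpleGraph V) : ℝ :=
  ∑ x, ∑ v, ∑ y, openInd G x v y

lemma openInd_nonneg {V : Type*} (G : SimpleGraph V) (x v y : V) : 0 ≤ openInd G x v y := by
  unfold openInd; split_ifs <;> norm_num

lemma openCount_nonneg {V : Type*} [Fintype V] (G : SimpleGraph V) : 0 ≤ openCount G :=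
  Finset.sum_nonneg fun _ _ => Finset.sum_nonneg fun _ _ => Finset.sum_nonneg fun _ _ =>
    openInd_nonneg G _ _ _

/-- The number of incidences of `z` with ordered open triplets. -/
noncomputable def openCountAt {V : Type*} [Fintype V] (G : SimpleGraph V) (z : V) : ℝ :=
  ∑ v, ∑ y, openInd G z v y + ∑ x, ∑ y, openInd G x z y + ∑ x, ∑ v, openInd G x v z

lemma sum_openCountAt {V : Type*} [Fintype V] (G : SimpleGraph V) :
    ∑ z, openCountAt G z = 3 * openCount G := by
  have h1 : ∑ z, ∑ x, ∑ y, openInd G x z y = openCount G := by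
    rw [Finset.sum_comm]; rfl
  have h2 : ∑ z, ∑ x, ∑ v, openInd G x v z = openCount G := by
    rw [Finset.sum_comm]
    refine Finset.sum_congr rfl fun x _ => ?_
    rw [Finset.sum_comm]
  simp only [openCountAt, Finset.sum_add_distrib]
  rw [h1, h2, openCount]; ring

/-- Triplets through `b` disappear, and the new vertex replaces `a` in copies of the triplets
through `a`. The last term is the defect: the edge from the new vertex to `b` is kept while `b`
loses its other edges, so up to `deg a + 1` pairs open up, in two orders. -/
lemma openCount_stepV1_le : openCount (stepV1 G a b) ≤
    openCount G - openCountAt G b + openCountAt G a + 2 * (clInd G a b * (G.degree a + 1)) := by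
  set G' := stepV1 G a b with hG'
  set u := Fin.last (n + 1) with hu
  have hold : ∀ x v y, openInd G' (Fin.castSucc x) (Fin.castSucc v) (Fin.castSucc y) ≤
      openInd G x v y - (if x = b then openInd G x v y else 0) -
        (if v = b then openInd G x v y else 0) - (if y = b then openInd G x v y else 0) := by
    intro x v y
    simp only [openInd, hG', stepV1_adj_castSucc, ne_eq, Fin.castSucc_inj]
    by_cases h : (G.Adj v x ∧ ¬v = b ∧ ¬x = b) ∧ (G.Adj v y ∧ ¬v = b ∧ ¬y = b) ∧ ¬x = y ∧
        ¬(G.Adj x y ∧ ¬x = b ∧ ¬y = b)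
    · have h' : G.Adj v x ∧ G.Adj v y ∧ ¬x = y ∧ ¬G.Adj x y :=
        ⟨h.1.1, h.2.1.1, h.2.2.1, fun hh => h.2.2.2 ⟨hh, h.1.2.2, h.2.1.2.2⟩⟩
      rw [if_pos h, if_pos h', if_neg h.1.2.1, if_neg h.1.2.2, if_neg h.2.1.2.2]
      norm_num
    · rw [if_neg h]
      by_cases h' : G.Adj v x ∧ G.Adj v y ∧ ¬x = y ∧ ¬G.Adj x y
      · rw [if_pos h']
        have hx : ¬ v = x := h'.1.ne
        have hy : ¬ v = y := h'.2.1.ne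
        have hxy := h'.2.2.1
        by_cases e1 : x = b
        · rw [if_pos e1, if_neg (e1 ▸ hx), if_neg fun e => hxy (e1.trans e.symm)]; norm_num
        by_cases e2 : v = b
        · rw [if_pos e2, if_neg e1, if_neg fun e => hy (e2.trans e.symm)]; norm_num
        rw [if_neg e1, if_neg e2]; split_ifs <;> norm_num
      · rw [if_neg h']; simp
  have hcen : ∀ x y, openInd G' (Fin.castSucc x) u (Fin.castSucc y) ≤
      openInd G x a y + (if x = b then clInd G a b * clInd G a y else 0) +
        (if y = b then clInd G a b * clInd G a x else 0) := by
    intro x y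
    have h0 := openInd_nonneg G x a y
    have h1 := mul_nonneg (clInd_nonneg G a b) (clInd_nonneg G a y)
    have h2 := mul_nonneg (clInd_nonneg G a b) (clInd_nonneg G a x)
    by_cases h : G'.Adj u x.castSucc ∧ G'.Adj u y.castSucc ∧ x.castSucc ≠ y.castSucc ∧
        ¬ G'.Adj x.castSucc y.castSucc
    · have h' := h
      rw [hG', hu, stepV1_adj_last, stepV1_adj_last, stepV1_adj_castSucc, ne_eq,
        Fin.castSucc_inj] at h'
      obtain ⟨hx, hy, hxy, hn⟩ := h'
      have e : openInd G' x.castSucc u y.castSucc = 1 := if_pos h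
      have ex : clInd G a x = 1 := if_pos hx
      have ey : clInd G a y = 1 := if_pos hy
      rw [e]
      by_cases hxb : x = b
      · have : ¬ y = b := fun hh => hxy (hxb.trans hh.symm)
        rw [if_pos hxb, if_neg this, ey, ← hxb, ex]; linarith
      by_cases hyb : y = b
      · rw [if_pos hyb, if_neg hxb, ex, ← hyb, ey]; linarith
      have hn' : ¬ G.Adj x y := fun hh => hn ⟨hh, hxb, hyb⟩
      -- Since `a` is adjacent to the rest of its closed neighbourhood, neither end of a nonadjacent
      -- pair there can be `a`.
      have hxa : G.Adj a x := hx.resolve_left fun hh => by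
        rcases hy with hy | hy
        · exact hxy (hh.trans hy.symm)
        · exact hn' (hh ▸ hy)
      have hya : G.Adj a y := hy.resolve_left fun hh => hn' (hh ▸ hxa.symm)
      have : openInd G x a y = 1 := if_pos ⟨hxa, hya, hxy, hn'⟩
      rw [this, if_neg hxb, if_neg hyb]; norm_num
    · have e : openInd G' x.castSucc u y.castSucc = 0 := if_neg h
      rw [e]; split_ifs <;> positivity
  -- The middle vertex cannot be `a`: its neighbour `y` would then be joined to the new vertex.
  have hend : ∀ v y, openInd G' u (Fin.castSucc v) (Fin.castSucc y) ≤ openInd G a v y := by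
    intro v y
    have h0 := openInd_nonneg G a v y
    unfold openInd at h0 ⊢
    split_ifs at h0 ⊢ with h h' <;> try norm_num
    rw [hG', hu, stepV1_adj_last, stepV1_adj_last', stepV1_adj_castSucc] at h
    obtain ⟨hv, ⟨hvy, -, -⟩, -, hn⟩ := h
    rw [not_or] at hn
    have : G.Adj a v := hv.resolve_left fun hh => hn.2 (hh ▸ hvy)
    exact h' ⟨this.symm, hvy, Ne.symm hn.1, hn.2⟩
  have hend' : ∀ x v, openInd G' (Fin.castSucc x) (Fin.castSucc v) u ≤ openInd G x v a := by
    intro x v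
    have hs : ∀ {V : Type} (H : SimpleGraph V) (x v y : V), openInd H x v y = openInd H y v x := by
      intro V H x v y
      simp only [openInd, H.adj_comm x y, ne_eq, eq_comm (a := x)]
      congr 1
      exact propext (by tauto)
    rw [hs, hs G]
    exact hend v x
  have hz1 : ∀ y, openInd G' u u y = 0 := fun y => by simp [openInd]
  have hz2 : ∀ x, openInd G' x u u = 0 := fun y => by simp [openInd]
  have hz3 : ∀ v, openInd G' u v u = 0 := fun y => by simp [openInd]
  calc openCount G' = ∑ x : Fin (n + 1), ∑ v : Fin (n + 1), ∑ y : Fin (n + 1),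
        openInd G' x.castSucc v.castSucc y.castSucc +
        ∑ x : Fin (n + 1), ∑ v : Fin (n + 1), openInd G' x.castSucc v.castSucc u +
        ∑ x : Fin (n + 1), ∑ y : Fin (n + 1), openInd G' x.castSucc u y.castSucc +
        ∑ v : Fin (n + 1), ∑ y : Fin (n + 1), openInd G' u v.castSucc y.castSucc := by
        simp only [openCount, Fin.sum_univ_castSucc (n := n + 1), ← hu, hz1, hz2, hz3,
          Finset.sum_add_distrib]
        simp
    _ ≤ ∑ x, ∑ v, ∑ y, (openInd G x v y - (if x = b then openInd G x v y else 0) -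
        (if v = b then openInd G x v y else 0) - (if y = b then openInd G x v y else 0)) +
        ∑ x, ∑ v, openInd G x v a +
        ∑ x, ∑ y, (openInd G x a y + (if x = b then clInd G a b * clInd G a y else 0) +
          (if y = b then clInd G a b * clInd G a x else 0)) +
        ∑ v, ∑ y, openInd G a v y := by
        gcongr with x _ v _ y _ x _ v _ x _ y _ v _ y _
        · exact hold x v y
        · exact hend' x v
        · exact hcen x y
        · exact hend v y
    _ = _ := by
        have e1 : ∑ x, ∑ v, ∑ y, (if x = b then openInd G x v y else 0) =
            ∑ v, ∑ y, openInd G b v y := by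
          rw [Finset.sum_eq_single b] <;> simp +contextual
        have e2 : ∑ x, ∑ v, ∑ y, (if v = b then openInd G x v y else 0) =
            ∑ x, ∑ y, openInd G x b y := by
          refine Finset.sum_congr rfl fun x _ => ?_
          rw [Finset.sum_eq_single b] <;> simp +contextual
        have e3 : ∑ x, ∑ y, (if x = b then clInd G a b * clInd G a y else 0) =
            clInd G a b * (G.degree a + 1) := by
          rw [Finset.sum_eq_single b] <;> simp +contextual [← Finset.mul_sum, sum_clInd]
        have e4 : ∑ x, clInd G a b * clInd G a x = clInd G a b * (G.degree a + 1) := by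
          rw [← Finset.mul_sum, sum_clInd]
        simp only [Finset.sum_sub_distrib, Finset.sum_add_distrib, e1, e2, e3,
          Finset.sum_ite_eq', Finset.mem_univ, if_true, e4]
        simp only [openCount, openCountAt]
        ring

/-- As `a` and `b` are both uniform, creation and destruction have the same average, and only the
defect term remains. -/
lemma selectAvg_openCount_le : selectAvg (fun a b => openCount (stepV1 G a b)) ≤
    openCount G + 2 * degreeSqSum G / (n + 1) ^ 2 := by
  refine (selectAvg_mono (openCount_stepV1_le G)).trans (le_of_eq ?_)
  have h : ∀ a, ∑ b, clInd G a b * ((G.degree a : ℝ) + 1) = ((G.degree a : ℝ) + 1) ^ 2 := by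
    intro a
    rw [← Finset.sum_mul, sum_clInd]; ring
  unfold selectAvg
  rw [div_eq_iff (by positivity)]
  simp only [Finset.sum_add_distrib, Finset.sum_sub_distrib, ← Finset.mul_sum, h, Finset.sum_const,
    sum_openCountAt, Finset.card_univ, Fintype.card_fin, nsmul_eq_mul]
  rw [← degreeSqSum]
  push_cast
  field_simp
  ring

/-! ### Degree counts: linearised change in one step. -/

/-- The number of vertices of degree `d`, as a real number. -/
lemma degreeCount_eq_sum {V : Type*} [Fintype V] (G : SimpleGraph V) (d : ℕ) :
    (degreeCount G d : ℝ) = ∑ v, if G.degree v = d then (1 : ℝ) else 0 := by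
  simp [degreeCount]

/-- The change of `degreeCount G d` caused by the first choice, to first order. -/
noncomputable def firstDrift (G : SimpleGraph (Fin (n + 1))) (d : ℕ) (a : Fin (n + 1)) : ℝ :=
  ∑ v, clInd G v a * ((if G.degree v + 1 = d then 1 else 0) - if G.degree v = d then 1 else 0)
    + if G.degree a + 1 = d then 1 else 0

/-- The change of `degreeCount G d` caused by the second choice, to first order. -/
noncomputable def secondDrift (G : SimpleGraph (Fin (n + 1))) (d : ℕ) (b : Fin (n + 1)) : ℝ :=
  ∑ v, nbInd G v b * ((if G.degree v = d + 1 then 1 else 0) - if G.degree v = d then 1 else 0)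
    + ((if d = 0 then 1 else 0) - if G.degree b = d then 1 else 0)

lemma abs_ite_sub_ite_le (p q : Prop) [Decidable p] [Decidable q] :
    |(if p then (1 : ℝ) else 0) - if q then 1 else 0| ≤ 1 := by
  split_ifs <;> norm_num

lemma abs_ite_le (p : Prop) [Decidable p] : |if p then (1 : ℝ) else 0| ≤ 1 := by
  split_ifs <;> norm_num

lemma abs_firstDrift_le (d : ℕ) : |firstDrift G d a| ≤ G.degree a + 2 := by
  have h := Finset.abs_sum_le_sum_abs (fun v => clInd G v a *
    ((if G.degree v + 1 = d then (1 : ℝ) else 0) - if G.degree v = d then 1 else 0)) Finset.univ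
  have h2 : ∑ v, |clInd G v a *
      ((if G.degree v + 1 = d then (1 : ℝ) else 0) - if G.degree v = d then 1 else 0)| ≤
      ∑ v, clInd G v a := by
    refine Finset.sum_le_sum fun v _ => ?_
    rw [abs_mul, abs_of_nonneg (clInd_nonneg G v a)]
    exact mul_le_of_le_one_right (clInd_nonneg G v a) (abs_ite_sub_ite_le _ _)
  rw [sum_clInd'] at h2
  refine (abs_add_le _ _).trans ?_
  linarith [abs_ite_le (G.degree a + 1 = d)]

lemma abs_secondDrift_le (d : ℕ) : |secondDrift G d b| ≤ G.degree b + 1 := by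
  have h := Finset.abs_sum_le_sum_abs (fun v => nbInd G v b *
    ((if G.degree v = d + 1 then (1 : ℝ) else 0) - if G.degree v = d then 1 else 0)) Finset.univ
  have h2 : ∑ v, |nbInd G v b *
      ((if G.degree v = d + 1 then (1 : ℝ) else 0) - if G.degree v = d then 1 else 0)| ≤
      ∑ v, nbInd G v b := by
    refine Finset.sum_le_sum fun v _ => ?_
    rw [abs_mul, abs_of_nonneg (nbInd_nonneg G v b)]
    exact mul_le_of_le_one_right (nbInd_nonneg G v b) (abs_ite_sub_ite_le _ _)
  rw [sum_nbInd'] at h2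
  refine (abs_add_le _ _).trans ?_
  linarith [abs_ite_sub_ite_le (d = 0) (G.degree b = d)]

/-- A vertex of degree `d - 1` enters the class for `d` choices of `a` and yields a new member when
it is duplicated itself, hence the factor `d + 1`; a vertex of degree `d` leaves for `d + 1`
choices. -/
lemma sum_firstDrift (d : ℕ) : ∑ a, firstDrift G d a =
    ((d : ℝ) + 1) * ((if d = 0 then 0 else (degreeCount G (d - 1) : ℝ)) - degreeCount G d) := by
  have h0 : (if d = 0 then 0 else (degreeCount G (d - 1) : ℝ)) =
      ∑ v, if G.degree v + 1 = d then (1 : ℝ) else 0 := by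
    cases d with
    | zero => simp
    | succ d => simp [degreeCount_eq_sum]
  rw [h0, degreeCount_eq_sum, ← Finset.sum_sub_distrib, Finset.mul_sum]
  simp only [firstDrift, Finset.sum_add_distrib]
  rw [Finset.sum_comm]
  simp_rw [← Finset.sum_mul, sum_clInd]
  rw [← Finset.sum_add_distrib]
  refine Finset.sum_congr rfl fun v _ => ?_
  by_cases h1 : G.degree v + 1 = d
  · have : G.degree v ≠ d := by omega
    have hd : (d : ℝ) = G.degree v + 1 := by exact_mod_cast h1.symm
    rw [if_pos h1, if_neg this, hd]; ring
  · by_cases h2 : G.degree v = d <;> simp [h1, h2]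

lemma sum_secondDrift (d : ℕ) : ∑ b, secondDrift G d b =
    ((d : ℝ) + 1) * (degreeCount G (d + 1) - degreeCount G d) +
      (n + 1) * if d = 0 then 1 else 0 := by
  rw [degreeCount_eq_sum, degreeCount_eq_sum, ← Finset.sum_sub_distrib, Finset.mul_sum]
  have h0 : ((n : ℝ) + 1) * (if d = 0 then 1 else 0) =
      ∑ _v : Fin (n + 1), if d = 0 then (1 : ℝ) else 0 := by simp
  rw [h0, ← Finset.sum_add_distrib]
  simp only [secondDrift, Finset.sum_add_distrib]
  rw [Finset.sum_comm]
  simp_rw [← Finset.sum_mul, sum_nbInd]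
  rw [← Finset.sum_add_distrib, ← Finset.sum_add_distrib]
  refine Finset.sum_congr rfl fun v _ => ?_
  by_cases h1 : G.degree v = d + 1
  · simp [h1]
  · by_cases h2 : G.degree v = d <;> simp [h1, h2]; ring

/-- The linearisation is exact at a vertex touched by at most one choice. At a vertex touched by
both, the true change and the three drift terms are each at most `1` in absolute value, hence the
constant `4`. -/
lemma abs_degreeCount_stepV1_sub_le (d : ℕ) :
    |(degreeCount (stepV1 G a b) d : ℝ) - degreeCount G d - (firstDrift G d a + secondDrift G d b)|
      ≤ 4 * ∑ v, clInd G v a * clInd G v b := by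
  have hG : ∀ v, ((stepV1 G a b).degree v.castSucc : ℝ) =
    G.degree v + clInd G v a - nbInd G v b - if v = b then (G.degree v : ℝ) else 0 :=
      degree_stepV1_castSucc G a b
  have hl : (if (stepV1 G a b).degree (Fin.last (n + 1)) = d then (1 : ℝ) else 0) =
      if G.degree a + 1 = d then 1 else 0 := by
    have h1 : (stepV1 G a b).degree (Fin.last (n + 1)) = G.degree a + 1 := by
      exact_mod_cast degree_stepV1_last G a b
    rw [h1]
  set t : Fin (n + 1) → ℝ := fun v => (if (stepV1 G a b).degree v.castSucc = d then (1 : ℝ) else 0)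
      - (if G.degree v = d then 1 else 0)
      - clInd G v a * ((if G.degree v + 1 = d then 1 else 0) - if G.degree v = d then 1 else 0)
      - nbInd G v b * ((if G.degree v = d + 1 then 1 else 0) - if G.degree v = d then 1 else 0)
      - (if v = b then (if d = 0 then 1 else 0) - (if G.degree v = d then 1 else 0) else 0) with ht
  have hsum : (degreeCount (stepV1 G a b) d : ℝ) - degreeCount G d -
      (firstDrift G d a + secondDrift G d b) = ∑ v, t v := by
    rw [degreeCount_eq_sum, degreeCount_eq_sum, Fin.sum_univ_castSucc, hl, firstDrift, secondDrift,
      ht]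
    simp only [Finset.sum_sub_distrib, Finset.sum_ite_eq', Finset.mem_univ, if_true]
    ring
  rw [hsum, Finset.mul_sum]
  refine (Finset.abs_sum_le_sum_abs _ _).trans (Finset.sum_le_sum fun v _ => ?_)
  have hdeg := hG v
  by_cases h1 : a = v ∨ G.Adj v a <;> by_cases h2 : v = b
  · subst h2
    have e1 : clInd G v a = 1 := if_pos h1
    have e2 : clInd G v v = 1 := if_pos (Or.inl rfl)
    have e3 : nbInd G v v = 0 := if_neg G.irrefl
    simp only [ht, e1, e2, e3]
    split_ifs <;> norm_num
  · by_cases h3 : G.Adj v b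
    · have e1 : clInd G v a = 1 := if_pos h1
      have e2 : clInd G v b = 1 := if_pos (Or.inr h3)
      have e3 : nbInd G v b = 1 := if_pos h3
      simp only [ht, e1, e2, e3, h2]
      split_ifs <;> norm_num
    · have e1 : clInd G v a = 1 := if_pos h1
      have e3 : nbInd G v b = 0 := if_neg h3
      have e2 : clInd G v b = 0 := by rw [clInd_eq, e3, if_neg (Ne.symm h2), add_zero]
      rw [e1, e3, if_neg h2] at hdeg
      have hd : (stepV1 G a b).degree v.castSucc = G.degree v + 1 := by
        have : ((stepV1 G a b).degree v.castSucc : ℝ) = (G.degree v + 1 : ℕ) := by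
          rw [hdeg]; push_cast; ring
        exact_mod_cast this
      simp only [ht, e1, e2, e3, h2, hd, if_false]
      norm_num
  · subst h2
    have e1 : clInd G v a = 0 := if_neg h1
    have e3 : nbInd G v v = 0 := if_neg G.irrefl
    rw [e1, e3, if_pos rfl] at hdeg
    have hd : (stepV1 G a v).degree v.castSucc = 0 := by
      have : ((stepV1 G a v).degree v.castSucc : ℝ) = (0 : ℕ) := by rw [hdeg]; push_cast; ring
      exact_mod_cast this
    simp only [ht, e1, e3, hd, if_true, eq_comm (a := 0)]
    norm_num
  · have e1 : clInd G v a = 0 := if_neg h1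
    by_cases h3 : G.Adj v b
    · have e3 : nbInd G v b = 1 := if_pos h3
      rw [e1, e3, if_neg h2] at hdeg
      have hd : ((stepV1 G a b).degree v.castSucc = d) = (G.degree v = d + 1) := by
        have : ((stepV1 G a b).degree v.castSucc + 1 : ℕ) = G.degree v := by
          have : (((stepV1 G a b).degree v.castSucc + 1 : ℕ) : ℝ) = G.degree v := by
            push_cast; rw [hdeg]; ring
          exact_mod_cast this
        rw [← this, Nat.add_right_cancel_iff]
      simp only [ht, e1, e3, hd, h2, if_false]
      norm_num
    · have e3 : nbInd G v b = 0 := if_neg h3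
      rw [e1, e3, if_neg h2] at hdeg
      have hd : (stepV1 G a b).degree v.castSucc = G.degree v := by
        have : ((stepV1 G a b).degree v.castSucc : ℝ) = G.degree v := by rw [hdeg]; ring
        exact_mod_cast this
      simp only [ht, e1, e3, hd, h2, if_false]
      norm_num

/-- The change of `degreeCount G d` in a step, to first order. -/
noncomputable def linearDrift (G : SimpleGraph (Fin (n + 1))) (d : ℕ) (a b : Fin (n + 1)) : ℝ :=
  firstDrift G d a + secondDrift G d b

lemma selectAvg_linearDrift (d : ℕ) : selectAvg (linearDrift G d) =
    ((d + 1) * ((if d = 0 then 0 else (degreeCount G (d - 1) : ℝ)) + degreeCount G (d + 1)) -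
      (2 * d + 2) * degreeCount G d) / (n + 1) + if d = 0 then 1 else 0 := by
  unfold selectAvg linearDrift
  simp only [Finset.sum_add_distrib, Finset.sum_const, Finset.card_univ, Fintype.card_fin,
    nsmul_eq_mul, ← Finset.mul_sum, sum_firstDrift, sum_secondDrift]
  push_cast
  field_simp
  ring

lemma selectAvg_linearDrift_sq_le (d : ℕ) :
    selectAvg (fun a b => linearDrift G d a b ^ 2) ≤ 10 * degreeSqSum G / (n + 1) := by
  -- From `(x + y) ^ 2 ≤ 2 * x ^ 2 + 2 * y ^ 2` and `deg a + 2 ≤ 2 * (deg a + 1)`.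
  have h : ∀ a b, linearDrift G d a b ^ 2 ≤
      8 * ((G.degree a : ℝ) + 1) ^ 2 + 2 * ((G.degree b : ℝ) + 1) ^ 2 := by
    intro a b
    have ha : (0 : ℝ) ≤ G.degree a := by positivity
    have h1 : firstDrift G d a ^ 2 ≤ (G.degree a + 2) ^ 2 :=
      sq_le_sq' (abs_le.1 (abs_firstDrift_le G a d)).1 (abs_le.1 (abs_firstDrift_le G a d)).2
    have h2 : secondDrift G d b ^ 2 ≤ (G.degree b + 1) ^ 2 :=
      sq_le_sq' (abs_le.1 (abs_secondDrift_le G b d)).1 (abs_le.1 (abs_secondDrift_le G b d)).2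
    unfold linearDrift
    nlinarith [sq_nonneg (firstDrift G d a - secondDrift G d b)]
  refine (selectAvg_mono h).trans (le_of_eq ?_)
  unfold selectAvg degreeSqSum
  simp only [Finset.sum_add_distrib, Finset.sum_const, Finset.card_univ, Fintype.card_fin,
    nsmul_eq_mul, ← Finset.mul_sum]
  push_cast
  field_simp
  ring

lemma selectAvg_common_eq : selectAvg (fun a b => 4 * ∑ v, clInd G v a * clInd G v b) =
    4 * degreeSqSum G / (n + 1) ^ 2 := by
  unfold selectAvg degreeSqSum
  congr 1
  simp only [← Finset.mul_sum]
  congr 1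
  have : ∀ a : Fin (n + 1), ∑ b, ∑ v, clInd G v a * clInd G v b =
      ∑ v, clInd G v a * (G.degree v + 1) := by
    intro a
    rw [Finset.sum_comm]
    simp_rw [← Finset.mul_sum, sum_clInd]
  simp_rw [this]
  rw [Finset.sum_comm]
  simp_rw [← Finset.sum_mul, sum_clInd, sq]

end Step

/-! ### Clustering coefficients in terms of open triplets. -/

section Clustering

open scoped Classical

variable {V : Type*} [Fintype V] (G : SimpleGraph V)

/-- The set of ordered open triplets. -/
noncomputable def openTriplets : Finset (V × V × V) :=
  Finset.univ.filter fun p => G.Adj p.2.1 p.1 ∧ G.Adj p.2.1 p.2.2 ∧ p.1 ≠ p.2.2 ∧ ¬ G.Adj p.1 p.2.2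

lemma card_openTriplets : ((openTriplets G).card : ℝ) = openCount G := by
  simp only [openTriplets, openCount, openInd, Finset.card_filter, Nat.cast_sum,
    Fintype.sum_prod_type, Nat.cast_ite, Nat.cast_one, Nat.cast_zero]

/-- Three times the number of triangles is the number of closed triplets. -/
lemma three_mul_card_cliqueFinset : 3 * (G.cliqueFinset 3).card =
    ((connectedTriplets G).filter fun p => G.IsClique (p.2 : Set V)).card := by
  have h1 : 3 * (G.cliqueFinset 3).card =
      ((G.cliqueFinset 3).sigma fun t => (t : Finset V)).card := by
    rw [Finset.card_sigma, mul_comm, ← smul_eq_mul, ← Finset.sum_const]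
    refine Finset.sum_congr rfl fun t ht => ?_
    exact (SimpleGraph.mem_cliqueFinset_iff.1 ht).card_eq.symm
  rw [h1]
  refine Finset.card_bij' (fun p _ => ⟨p.2, p.1.erase p.2⟩) (fun p _ => ⟨insert p.1 p.2, p.1⟩)
    ?_ ?_ ?_ ?_
  · rintro ⟨t, v⟩ h
    rw [Finset.mem_sigma, SimpleGraph.mem_cliqueFinset_iff] at h
    obtain ⟨⟨hc, h3⟩, hv⟩ := h
    dsimp only at hc h3 hv
    simp only [connectedTriplets, Finset.mem_filter, Finset.mem_sigma, Finset.mem_univ, true_and,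
      Finset.mem_powersetCard]
    refine ⟨⟨fun x hx => ?_, by rw [Finset.card_erase_of_mem hv, h3]⟩,
      hc.subset (by simp [Finset.coe_erase])⟩
    rw [Finset.mem_erase] at hx
    rw [SimpleGraph.mem_neighborFinset]
    exact hc hv hx.2 hx.1.symm
  · rintro ⟨v, s⟩ h
    simp only [connectedTriplets, Finset.mem_filter, Finset.mem_sigma, Finset.mem_univ, true_and,
      Finset.mem_powersetCard] at h
    obtain ⟨⟨hs, h2⟩, hc⟩ := h
    have hadj : ∀ x ∈ s, G.Adj v x := fun x hx => (SimpleGraph.mem_neighborFinset _ _ _).1 (hs hx)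
    have hv : v ∉ s := fun h => G.irrefl (hadj v h)
    rw [Finset.mem_sigma, SimpleGraph.mem_cliqueFinset_iff]
    refine ⟨⟨?_, by rw [Finset.card_insert_of_notMem hv, h2]⟩, Finset.mem_insert_self _ _⟩
    rw [Finset.coe_insert]
    exact hc.insert fun x hx _ => hadj x hx
  · rintro ⟨t, v⟩ h
    rw [Finset.mem_sigma] at h
    simp [Finset.insert_erase h.2]
  · rintro ⟨v, s⟩ h
    simp only [connectedTriplets, Finset.mem_filter, Finset.mem_sigma, Finset.mem_univ, true_and,
      Finset.mem_powersetCard] at h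
    have hv : v ∉ s := fun hh => G.irrefl ((SimpleGraph.mem_neighborFinset _ _ _).1 (h.1.1 hh))
    simp [Finset.erase_insert hv]

lemma card_connectedTriplets_le :
    (connectedTriplets G).card ≤ 3 * (G.cliqueFinset 3).card + (openTriplets G).card := by
  rw [three_mul_card_cliqueFinset, ← Finset.card_filter_add_card_filter_not
    (fun p : (_ : V) × Finset V => G.IsClique (p.2 : Set V))]
  gcongr
  refine (Finset.card_le_card ?_).trans
    (Finset.card_image_le (s := openTriplets G) (f := fun p => ⟨p.2.1, {p.1, p.2.2}⟩))
  rintro ⟨v, s⟩ h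
  simp only [connectedTriplets, Finset.mem_filter, Finset.mem_sigma, Finset.mem_univ, true_and,
    Finset.mem_powersetCard] at h
  obtain ⟨⟨hs, h2⟩, hc⟩ := h
  obtain ⟨x, y, hxy, rfl⟩ := Finset.card_eq_two.1 h2
  refine Finset.mem_image.2 ⟨(x, v, y), ?_, rfl⟩
  simp only [openTriplets, Finset.mem_filter, Finset.mem_univ, true_and]
  have hx := (SimpleGraph.mem_neighborFinset _ _ _).1 (hs (by simp : x ∈ ({x, y} : Finset V)))
  have hy := (SimpleGraph.mem_neighborFinset _ _ _).1 (hs (by simp : y ∈ ({x, y} : Finset V)))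
  refine ⟨hx, hy, hxy, fun h => hc ?_⟩
  rw [Finset.coe_pair]
  exact SimpleGraph.isClique_pair.2 fun _ => h

lemma degreeCount_two_le : degreeCount G 2 ≤ (connectedTriplets G).card := by
  rw [connectedTriplets, Finset.card_sigma, degreeCount, Finset.card_filter]
  refine Finset.sum_le_sum fun v _ => ?_
  split_ifs with h
  · rw [Finset.card_powersetCard, SimpleGraph.card_neighborFinset_eq_degree, h]; rfl
  · exact Nat.zero_le _

lemma three_mul_card_cliqueFinset_le :
    3 * (G.cliqueFinset 3).card ≤ (connectedTriplets G).card := by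
  rw [three_mul_card_cliqueFinset]
  exact Finset.card_filter_le _ _

lemma globalClustering_le_one : globalClustering G ≤ 1 := by
  refine div_le_one_of_le₀ ?_ (Nat.cast_nonneg _)
  exact_mod_cast three_mul_card_cliqueFinset_le G

/-- Each vertex of degree `2` carries one connected triplet, which bounds the denominator from
below. -/
lemma one_sub_le_globalClustering (h : 0 < degreeCount G 2) :
    1 - openCount G / degreeCount G 2 ≤ globalClustering G := by
  have h2 : (0 : ℝ) < degreeCount G 2 := by exact_mod_cast h
  have h3 : (degreeCount G 2 : ℝ) ≤ (connectedTriplets G).card := by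
    exact_mod_cast degreeCount_two_le G
  have h4 : ((connectedTriplets G).card : ℝ) ≤ 3 * (G.cliqueFinset 3).card + openCount G := by
    rw [← card_openTriplets]; exact_mod_cast card_connectedTriplets_le G
  have h5 : openCount G / (connectedTriplets G).card ≤ openCount G / degreeCount G 2 :=
    div_le_div_of_nonneg_left (openCount_nonneg G) h2 h3
  have h6 : 1 - openCount G / (connectedTriplets G).card ≤ globalClustering G := by
    unfold globalClustering
    rw [sub_le_iff_le_add, ← add_div, le_div_iff₀ (h2.trans_le h3)]
    linarith
  linarith

lemma localClustering_nonneg (v : V) : 0 ≤ localClustering G v := by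
  unfold localClustering
  split_ifs <;> positivity

lemma localClustering_le (v : V) : localClustering G v ≤ if G.degree v < 2 then 0 else 1 := by
  unfold localClustering
  split_ifs
  · exact le_rfl
  · refine div_le_one_of_le₀ ?_ (Nat.cast_nonneg _)
    have h := (G.induce (G.neighborSet v)).card_edgeFinset_le_card_choose_two
    rw [SimpleGraph.card_neighborSet_eq_degree] at h
    exact_mod_cast h

lemma localClustering_eq_one {v : V} (hd : ¬ G.degree v < 2)
    (h : ∀ x y, G.Adj v x → G.Adj v y → x ≠ y → G.Adj x y) : localClustering G v = 1 := by
  have htop : G.induce (G.neighborSet v) = ⊤ := by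
    ext x y
    simp only [SimpleGraph.comap_adj, Function.Embedding.subtype_apply, SimpleGraph.top_adj, ne_eq]
    refine ⟨fun hh he => G.irrefl (he ▸ hh), fun hh => h x y x.2 y.2 fun e => hh (Subtype.ext e)⟩
  have hcard : (G.induce (G.neighborSet v)).edgeFinset.card = (G.degree v).choose 2 := by
    -- Generalising over the graph and its `Fintype` instance allows `⊤` to be substituted.
    have key : ∀ (H : SimpleGraph (G.neighborSet v)) [Fintype H.edgeSet], H = ⊤ →
        H.edgeFinset.card = (Fintype.card (G.neighborSet v)).choose 2 := by
      intro H _ hH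
      subst hH
      rw [← SimpleGraph.card_edgeFinset_top_eq_card_choose_two]
      congr
      exact Subsingleton.elim _ _
    rw [key _ htop, SimpleGraph.card_neighborSet_eq_degree]
  rw [localClustering, if_neg hd, hcard, div_self]
  exact_mod_cast (Nat.choose_pos (not_lt.1 hd)).ne'

/-- If the coefficient is not the maximal one, some open triplet is centred at `v`, and the sum
subtracted is already at least `1`. -/
lemma le_localClustering (v : V) :
    (if G.degree v < 2 then 0 else 1) - ∑ x, ∑ y, openInd G x v y ≤ localClustering G v := by
  have h0 : 0 ≤ ∑ x, ∑ y, openInd G x v y :=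
    Finset.sum_nonneg fun _ _ => Finset.sum_nonneg fun _ _ => openInd_nonneg G _ _ _
  have h1 := localClustering_nonneg G v
  by_cases hd : G.degree v < 2
  · rw [if_pos hd]; linarith
  rw [if_neg hd]
  by_cases h : ∀ x y, G.Adj v x → G.Adj v y → x ≠ y → G.Adj x y
  · rw [localClustering_eq_one G hd h]; linarith
  · push Not at h
    obtain ⟨x, y, hx, hy, hxy, hn⟩ := h
    have h2 : (1 : ℝ) ≤ ∑ x, ∑ y, openInd G x v y := by
      calc (1 : ℝ) = openInd G x v y := (if_pos ⟨hx, hy, hxy, hn⟩).symm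
        _ ≤ ∑ y, openInd G x v y :=
          Finset.single_le_sum (f := fun y => openInd G x v y)
            (fun _ _ => openInd_nonneg G _ _ _) (Finset.mem_univ y)
        _ ≤ _ := Finset.single_le_sum (f := fun x => ∑ y, openInd G x v y)
            (fun _ _ => Finset.sum_nonneg fun _ _ => openInd_nonneg G _ _ _) (Finset.mem_univ x)
    linarith

lemma sum_degree_lt_two : ∑ v, (if G.degree v < 2 then (0 : ℝ) else 1) =
    Fintype.card V - degreeCount G 0 - degreeCount G 1 := by
  have : (Fintype.card V : ℝ) = ∑ _v : V, 1 := by simp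
  rw [degreeCount_eq_sum, degreeCount_eq_sum, this, ← Finset.sum_sub_distrib,
    ← Finset.sum_sub_distrib]
  refine Finset.sum_congr rfl fun v _ => ?_
  rcases h : G.degree v with _ | _ | k
  · simp
  · simp
  · simp

lemma abs_averageClustering_sub_le [Nonempty V] :
    |averageClustering G - (1 - (degreeCount G 0 : ℝ) / Fintype.card V -
      (degreeCount G 1 : ℝ) / Fintype.card V)| ≤ openCount G / Fintype.card V := by
  have hc : (0 : ℝ) < Fintype.card V := by exact_mod_cast Fintype.card_pos
  have h1 := Finset.sum_le_sum fun v (_ : v ∈ Finset.univ) => localClustering_le G v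
  have h2 := Finset.sum_le_sum fun v (_ : v ∈ Finset.univ) => le_localClustering G v
  have h3 : ∑ v, ∑ x, ∑ y, openInd G x v y = openCount G := by
    rw [Finset.sum_comm]; rfl
  rw [Finset.sum_sub_distrib, h3, sum_degree_lt_two] at h2
  rw [sum_degree_lt_two] at h1
  have e : averageClustering G - (1 - (degreeCount G 0 : ℝ) / Fintype.card V -
      (degreeCount G 1 : ℝ) / Fintype.card V) = (∑ v, localClustering G v -
      (Fintype.card V - degreeCount G 0 - degreeCount G 1)) / Fintype.card V := by
    unfold averageClustering; field_simp
  have := openCount_nonneg G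
  rw [e, abs_div, abs_of_pos hc]
  gcongr
  rw [abs_le]
  constructor <;> linarith

end Clustering

/-! ### The infinite coupled recursion. -/

/-- Bounded solutions of the coupled stochastic approximation recursions, with convergent noise
series, tend to zero. -/
lemma tendsto_zero_of_coupled_recursion {y e : ℕ → ℕ → ℝ} {K : ℝ} (hK : ∀ d n, |y d n| ≤ K)
    (he : ∀ d, ∃ l, Tendsto (fun n => ∑ k ∈ Finset.range n, e d k) atTop (𝓝 l))
    (hy : ∀ d n : ℕ, y d (n + 1) = y d n + (((d : ℝ) + 1) *
      ((if d = 0 then 0 else y (d - 1) n) + y (d + 1) n) - (2 * d + 3) * y d n) / (n + 2) + e d n)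
    (d : ℕ) : Tendsto (y d) atTop (𝓝 0) := by
  set L : ℕ → ℝ := fun d => limsup (fun n => |y d n|) atTop with hL
  have hbdd : ∀ d, IsBoundedUnder (· ≤ ·) atTop fun n => |y d n| := fun d =>
    isBoundedUnder_of ⟨K, hK d⟩
  have hcob : ∀ d, IsCoboundedUnder (· ≤ ·) atTop fun n => |y d n| := fun d =>
    IsBoundedUnder.isCoboundedUnder_le (isBoundedUnder_of ⟨0, fun n => abs_nonneg _⟩)
  have hev : ∀ d, ∀ ε > 0, ∀ᶠ n in atTop, |y d n| ≤ L d + ε := fun d ε hε => by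
    filter_upwards [eventually_lt_of_limsup_lt (show L d < L d + ε by linarith) (hbdd d)]
      with n hn using hn.le
  have hL0 : ∀ d, 0 ≤ L d := fun d =>
    le_limsup_of_frequently_le (Frequently.of_forall fun n => abs_nonneg _) (hbdd d)
  have hLK : ∀ d, L d ≤ K := fun d => limsup_le_of_le (hcob d) (Eventually.of_forall (hK d))
  -- Each coordinate is treated as a one-dimensional recursion driven by its two neighbours, so no
  -- uniformity in `d` is needed beyond the bound `K`.
  have hsub : ∀ d : ℕ, (2 * (d : ℝ) + 3) * L d ≤
      ((d : ℝ) + 1) * ((if d = 0 then 0 else L (d - 1)) + L (d + 1)) := by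
    intro d
    set γ := ((d : ℝ) + 1) * ((if d = 0 then 0 else L (d - 1)) + L (d + 1)) with hγ
    have hκ : (0 : ℝ) < 2 * d + 3 := by positivity
    obtain ⟨l, hl⟩ := he d
    have key : ∀ ε > 0, L d ≤ γ / (2 * d + 3) + ε := by
      intro ε hε
      refine limsup_le_of_le (hcob d) (eventually_abs_le_of_recursion
        (by have : (0 : ℝ) ≤ d := by positivity
            linarith) (hy d) hl ?_ hε)
      intro δ hδ
      have hd : (0 : ℝ) < d + 1 := by positivity
      have h1 : ∀ᶠ n in atTop, |if d = 0 then 0 else y (d - 1) n| ≤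
          (if d = 0 then 0 else L (d - 1)) + δ / (2 * (d + 1)) := by
        split_ifs
        · exact Eventually.of_forall fun n => by rw [abs_zero]; positivity
        · exact hev _ _ (by positivity)
      filter_upwards [h1, hev (d + 1) (δ / (2 * (d + 1))) (by positivity)] with n hn1 hn2
      rw [abs_mul, abs_of_pos hd]
      calc ((d : ℝ) + 1) * |(if d = 0 then 0 else y (d - 1) n) + y (d + 1) n|
          ≤ (d + 1) * (((if d = 0 then 0 else L (d - 1)) + δ / (2 * (d + 1))) +
            (L (d + 1) + δ / (2 * (d + 1)))) := by
            gcongr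
            exact (abs_add_le _ _).trans (add_le_add hn1 hn2)
        _ = γ + δ := by rw [hγ]; field_simp; ring
    have := le_of_forall_pos_le_add key
    rwa [le_div_iff₀ hκ, mul_comm] at this
  have hzero := eq_zero_of_bounded_subsolution hL0 hLK hsub d
  rw [tendsto_zero_iff_abs_tendsto_zero, Metric.tendsto_nhds]
  intro ε hε
  filter_upwards [hev d (ε / 2) (by positivity)] with n hn
  simp only [Function.comp_apply, Real.dist_eq, sub_zero, abs_abs]
  linarith

/-! ### Martingale convergence tools. -/

section Probability

variable {Ω : Type*} [mΩ : MeasurableSpace Ω] {μ : Measure Ω}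

lemma ae_summable_of_summable_integral {f : ℕ → Ω → ℝ} (hf : ∀ n, Integrable (f n) μ)
    (h0 : ∀ n ω, 0 ≤ f n ω) (hs : Summable fun n => ∫ ω, f n ω ∂μ) :
    ∀ᵐ ω ∂μ, Summable fun n => f n ω := by
  have h1 : ∫⁻ ω, ∑' n, ENNReal.ofReal (f n ω) ∂μ ≠ ⊤ := by
    rw [lintegral_tsum fun n => (hf n).aemeasurable.ennreal_ofReal]
    simp_rw [← ofReal_integral_eq_lintegral_ofReal (hf _) (ae_of_all _ (h0 _))]
    rw [← ENNReal.ofReal_tsum_of_nonneg (fun n => integral_nonneg (h0 n)) hs]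
    exact ENNReal.ofReal_ne_top
  filter_upwards [ae_lt_top' (AEMeasurable.tsum fun n =>
    (hf n).aemeasurable.ennreal_ofReal) h1] with ω hω
  have := ENNReal.summable_toReal hω.ne
  simpa only [ENNReal.toReal_ofReal (h0 _ ω)] using this

variable [IsProbabilityMeasure μ]

/-- A series of bounded martingale differences with summable variances converges. -/
lemma ae_exists_tendsto_sum_martingaleDiff {F : Filtration ℕ mΩ} {ζ : ℕ → Ω → ℝ} {K : ℕ → ℝ}
    {C : ℝ} (hmeas : ∀ k, StronglyMeasurable[F (k + 1)] (ζ k)) (hK : ∀ k ω, |ζ k ω| ≤ K k)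
    (hζ : ∀ k, μ[ζ k | F k] =ᵐ[μ] 0)
    (hC : ∀ n, ∑ k ∈ Finset.range n, ∫ ω, ζ k ω ^ 2 ∂μ ≤ C) :
    ∀ᵐ ω ∂μ, ∃ l, Tendsto (fun n => ∑ k ∈ Finset.range n, ζ k ω) atTop (𝓝 l) := by
  set M : ℕ → Ω → ℝ := fun n ω => ∑ k ∈ Finset.range n, ζ k ω with hM
  have hMm : ∀ n, StronglyMeasurable[F n] (M n) := fun n => by
    refine Finset.stronglyMeasurable_fun_sum _ fun k hk => (hmeas k).mono (F.mono ?_)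
    have := Finset.mem_range.1 hk
    omega
  have hMb : ∀ n ω, |M n ω| ≤ ∑ k ∈ Finset.range n, K k := fun n ω =>
    (Finset.abs_sum_le_sum_abs _ _).trans (Finset.sum_le_sum fun k _ => hK k ω)
  have hint : ∀ {f : Ω → ℝ} {n : ℕ} {c : ℝ}, StronglyMeasurable[F n] f → (∀ ω, |f ω| ≤ c) →
      Integrable f μ := fun {f n c} hf hc =>
    Integrable.of_bound (hf.mono (F.le n)).aestronglyMeasurable c (ae_of_all _ hc)
  have hMi : ∀ n, Integrable (M n) μ := fun n => hint (hMm n) (hMb n)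
  have hζi : ∀ k, Integrable (ζ k) μ := fun k => hint (hmeas k) (hK k)
  have hsucc : ∀ n, M (n + 1) = M n + ζ n := fun n => by
    ext ω; simp [hM, Finset.sum_range_succ]
  have hmart : Martingale M F μ := by
    refine martingale_nat hMm hMi fun n => ?_
    have h1 := condExp_add (hMi n) (hζi n) (F n)
    rw [hsucc]
    filter_upwards [h1, hζ n] with ω h1 h2
    rw [h1, Pi.add_apply, h2, condExp_of_stronglyMeasurable (F.le n) (hMm n) (hMi n)]
    simp
  have hsq : ∀ n, ∫ ω, M n ω ^ 2 ∂μ ≤ ∑ k ∈ Finset.range n, ∫ ω, ζ k ω ^ 2 ∂μ := by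
    intro n
    induction n with
    | zero => simp [hM]
    | succ n ih =>
      have hb : ∀ {f g : Ω → ℝ} {c c' : ℝ}, (∀ ω, |f ω| ≤ c) → (∀ ω, |g ω| ≤ c') →
          ∀ ω, |(f * g) ω| ≤ c * c' := fun {f g c c'} h1 h2 ω => by
        rw [Pi.mul_apply, abs_mul]
        exact mul_le_mul (h1 ω) (h2 ω) (abs_nonneg _) ((abs_nonneg _).trans (h1 ω))
      have hMm' : StronglyMeasurable[F (n + 1)] (M n) := (hMm n).mono (F.mono n.le_succ)
      have i1 : Integrable (M n * M n) μ := hint ((hMm n).mul (hMm n)) (hb (hMb n) (hMb n))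
      have i2 : Integrable (M n * ζ n) μ := hint (hMm'.mul (hmeas n)) (hb (hMb n) (hK n))
      have i3 : Integrable (ζ n * ζ n) μ := hint ((hmeas n).mul (hmeas n)) (hb (hK n) (hK n))
      -- Orthogonality of the increment to the past, which makes the second moments add up.
      have hz : ∫ ω, (M n * ζ n) ω ∂μ = 0 := by
        rw [← integral_condExp (F.le n)]
        have := condExp_mul_of_stronglyMeasurable_left (hMm n) i2 (hζi n)
        rw [integral_congr_ae (this.trans ?_), integral_zero]
        filter_upwards [hζ n] with ω hω
        simp [hω]
      have e : (fun ω => M (n + 1) ω ^ 2) =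
          fun ω => (M n * M n) ω + 2 * (M n * ζ n) ω + (ζ n * ζ n) ω := by
        ext ω; rw [hsucc]; simp only [Pi.add_apply, Pi.mul_apply]; ring
      have i4 : Integrable (fun ω => (M n * M n) ω + 2 * (M n * ζ n) ω) μ := i1.add (i2.const_mul 2)
      rw [e, integral_add i4 i3, integral_add i1 (i2.const_mul 2),
        integral_const_mul, hz, Finset.sum_range_succ]
      simp only [Pi.mul_apply, ← sq] at ih ⊢
      linarith
  have hR : ∀ n, eLpNorm (M n) 1 μ ≤ (Real.toNNReal (1 + C) : NNReal) := by
    intro n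
    have i1 : Integrable (fun ω => M n ω ^ 2) μ := by
      refine hint (c := (∑ k ∈ Finset.range n, K k) ^ 2) ((hMm n).pow 2) fun ω => ?_
      rw [abs_pow]
      exact pow_le_pow_left₀ (abs_nonneg _) (hMb n ω) 2
    have h1 : ∫ ω, ‖M n ω‖ ∂μ ≤ 1 + C := by
      calc ∫ ω, ‖M n ω‖ ∂μ ≤ ∫ ω, (1 + M n ω ^ 2) ∂μ := by
            refine integral_mono (hMi n).norm ((integrable_const 1).add i1) fun ω => ?_
            rw [Real.norm_eq_abs, ← sq_abs]
            nlinarith [sq_nonneg (|M n ω| - 1), sq_nonneg (|M n ω|)]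
        _ = 1 + ∫ ω, M n ω ^ 2 ∂μ := by
            rw [integral_add (integrable_const 1) i1]; simp
        _ ≤ 1 + C := by linarith [hsq n, hC n]
    rw [eLpNorm_one_eq_lintegral_enorm, ← ofReal_integral_norm_eq_lintegral_enorm (hMi n)]
    exact ENNReal.ofReal_le_ofReal h1
  filter_upwards [hmart.submartingale.ae_tendsto_limitProcess hR] with ω hω using ⟨_, hω⟩

/-- A nonnegative almost supermartingale whose expectations vanish in the limit tends to zero. -/
lemma ae_tendsto_zero_of_almost_supermartingale {F : Filtration ℕ mΩ} {Y e : ℕ → Ω → ℝ}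
    (hYm : ∀ n, StronglyMeasurable[F n] (Y n)) (hem : ∀ n, StronglyMeasurable[F n] (e n))
    (hYi : ∀ n, Integrable (Y n) μ) (hei : ∀ n, Integrable (e n) μ)
    (hY0 : ∀ n ω, 0 ≤ Y n ω) (he0 : ∀ n ω, 0 ≤ e n ω)
    (hY : ∀ n, μ[Y (n + 1) | F n] ≤ᵐ[μ] Y n + e n)
    (hes : Summable fun n => ∫ ω, e n ω ∂μ)
    (hlim : Tendsto (fun n => ∫ ω, Y n ω ∂μ) atTop (𝓝 0)) :
    ∀ᵐ ω ∂μ, Tendsto (fun n => Y n ω) atTop (𝓝 0) := by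
  set S : ℕ → Ω → ℝ := fun n ω => ∑ k ∈ Finset.range n, e k ω with hS
  have hSm : ∀ n, StronglyMeasurable[F n] (S n) := fun n =>
    Finset.stronglyMeasurable_fun_sum _ fun k hk =>
      (hem k).mono (F.mono (Finset.mem_range.1 hk).le)
  have hSm' : ∀ n, StronglyMeasurable[F n] (S (n + 1)) := fun n =>
    Finset.stronglyMeasurable_fun_sum _ fun k hk =>
      (hem k).mono (F.mono (Nat.lt_succ_iff.1 (Finset.mem_range.1 hk)))
  have hSi : ∀ n, Integrable (S n) μ := fun n => integrable_finsetSum _ fun k _ => hei k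
  -- Subtracting the accumulated errors gives an `L¹`-bounded supermartingale. It converges, as does
  -- `S`, so `Y` converges.
  have hsuper : Supermartingale (fun n => Y n - S n) F μ := by
    refine supermartingale_nat (fun n => (hYm n).sub (hSm n)) (fun n => (hYi n).sub (hSi n))
      fun n => ?_
    have h1 := condExp_sub (hYi (n + 1)) (hSi (n + 1)) (F n)
    filter_upwards [h1, hY n] with ω h1 h2
    rw [h1, Pi.sub_apply, condExp_of_stronglyMeasurable (F.le n) (hSm' n) (hSi (n + 1))]
    simp only [Pi.sub_apply, Pi.add_apply, hS, Finset.sum_range_succ] at h2 ⊢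
    linarith
  obtain ⟨C, hC⟩ := hlim.bddAbove_range
  have hR : ∀ n, eLpNorm ((-fun n => Y n - S n) n) 1 μ ≤
      (Real.toNNReal (C + ∑' n, ∫ ω, e n ω ∂μ) : NNReal) := by
    intro n
    have h1 : ∫ ω, ‖(Y n - S n) ω‖ ∂μ ≤ C + ∑' n, ∫ ω, e n ω ∂μ := by
      calc ∫ ω, ‖(Y n - S n) ω‖ ∂μ ≤ ∫ ω, (Y n ω + S n ω) ∂μ := by
            refine integral_mono ((hYi n).sub (hSi n)).norm ((hYi n).add (hSi n)) fun ω => ?_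
            have h0 : 0 ≤ S n ω := Finset.sum_nonneg fun k _ => he0 k ω
            have := hY0 n ω
            simp only [Pi.sub_apply, Real.norm_eq_abs]
            rw [abs_le]; constructor <;> linarith
        _ = ∫ ω, Y n ω ∂μ + ∑ k ∈ Finset.range n, ∫ ω, e k ω ∂μ := by
            rw [integral_add (hYi n) (hSi n), integral_finsetSum _ fun k _ => hei k]
        _ ≤ _ := add_le_add (hC ⟨n, rfl⟩)
            (hes.sum_le_tsum _ fun k _ => integral_nonneg (he0 k))
    have e1 : (-fun n => Y n - S n) n = -(Y n - S n) := rfl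
    rw [e1, eLpNorm_neg, eLpNorm_one_eq_lintegral_enorm,
      ← ofReal_integral_norm_eq_lintegral_enorm ((hYi n).sub (hSi n))]
    exact ENNReal.ofReal_le_ofReal h1
  -- Fatou's lemma identifies the limit of `Y` as zero.
  have hfatou : ∀ᵐ ω ∂μ, liminf (fun n => ENNReal.ofReal (Y n ω)) atTop = 0 := by
    have hm : ∀ n, Measurable fun ω => ENNReal.ofReal (Y n ω) := fun n =>
      ((hYm n).mono (F.le n)).measurable.ennreal_ofReal
    have h1 : ∫⁻ ω, liminf (fun n => ENNReal.ofReal (Y n ω)) atTop ∂μ ≤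
        liminf (fun n => ∫⁻ ω, ENNReal.ofReal (Y n ω) ∂μ) atTop := lintegral_liminf_le hm
    have h2 : Tendsto (fun n => ∫⁻ ω, ENNReal.ofReal (Y n ω) ∂μ) atTop (𝓝 0) := by
      simp_rw [← ofReal_integral_eq_lintegral_ofReal (hYi _) (ae_of_all _ (hY0 _))]
      simpa [Function.comp_def] using (ENNReal.continuous_ofReal.tendsto 0).comp hlim
    rw [h2.liminf_eq, nonpos_iff_eq_zero, lintegral_eq_zero_iff (.liminf hm)] at h1
    exact h1
  filter_upwards [hsuper.neg.ae_tendsto_limitProcess hR, hfatou,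
    ae_summable_of_summable_integral hei he0 hes] with ω h1 h2 h3
  have h4 := (h1.neg.add h3.hasSum.tendsto_sum_nat)
  simp only [Pi.neg_apply, Pi.sub_apply, neg_neg, hS, sub_add_cancel] at h4
  have h5 := (ENNReal.continuous_ofReal.tendsto _).comp h4
  have h6 := h5.liminf_eq
  rw [show liminf (ENNReal.ofReal ∘ fun n => Y n ω) atTop = 0 from h2] at h6
  have h7 := ge_of_tendsto' h4 fun n => hY0 n ω
  rw [le_antisymm (ENNReal.ofReal_eq_zero.1 h6.symm) h7] at h4
  exact h4

end Probability

/-! ### The random graph, its filtration and conditional expectations. -/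

section Selection

variable {Ω : Type*} {A B : (n : ℕ) → Ω → Fin (n + 1)}

/-- The random graph after `n` steps. -/
noncomputable def randomGraph (A B : (n : ℕ) → Ω → Fin (n + 1)) (n : ℕ) (ω : Ω) :
    SimpleGraph (Fin (n + 1)) :=
  graphV1 (fun k => A k ω) (fun k => B k ω) n

lemma randomGraph_succ (n : ℕ) (ω : Ω) :
    randomGraph A B (n + 1) ω = stepV1 (randomGraph A B n ω) (A n ω) (B n ω) := rfl

lemma measurableSet_select (n : ℕ) (a b : Fin (n + 1)) :
    MeasurableSet[MeasurableSpace.comap (fun ω => (A n ω, B n ω)) inferInstance]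
      {ω | A n ω = a ∧ B n ω = b} :=
  ⟨{(a, b)}, measurableSet_singleton _, by ext; simp⟩

variable [mΩ : MeasurableSpace Ω] {μ : Measure Ω}

namespace IsUniformSelection

lemma measurable_pair (h : IsUniformSelection μ A B) (n : ℕ) :
    Measurable fun ω => (A n ω, B n ω) :=
  (h.measurable_fst n).prodMk (h.measurable_snd n)

/-- The filtration generated by the choices of the first `n` steps. -/
def past (h : IsUniformSelection μ A B) : Filtration ℕ mΩ where
  seq n := ⨆ k ∈ Set.Iio n, MeasurableSpace.comap (fun ω => (A k ω, B k ω)) inferInstance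
  mono' _ _ hmn := biSup_mono fun _ hk => lt_of_lt_of_le hk hmn
  le' _ := iSup₂_le fun k _ => (h.measurable_pair k).comap_le

lemma comap_le_past (h : IsUniformSelection μ A B) (n : ℕ) :
    MeasurableSpace.comap (fun ω => (A n ω, B n ω)) inferInstance ≤ h.past (n + 1) :=
  le_biSup (fun k => MeasurableSpace.comap (fun ω => (A k ω, B k ω)) inferInstance)
    (Set.mem_Iio.2 n.lt_succ_self)

lemma measurable_randomGraph (h : IsUniformSelection μ A B) (n : ℕ) :
    Measurable[h.past n, ⊤] (randomGraph A B n) := by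
  induction n with
  | zero =>
    have : randomGraph A B 0 = fun _ => ⊥ := by ext; rfl
    rw [this]
    exact @measurable_const _ _ ⊤ (h.past 0) _
  | succ n ih =>
    intro s _
    have e : randomGraph A B (n + 1) ⁻¹' s = ⋃ (G : SimpleGraph (Fin (n + 1)))
        (a : Fin (n + 1)) (b : Fin (n + 1)) (_ : stepV1 G a b ∈ s),
        randomGraph A B n ⁻¹' {G} ∩ {ω | A n ω = a ∧ B n ω = b} := by
      ext ω
      simp only [Set.mem_preimage, randomGraph_succ, Set.mem_iUnion, Set.mem_inter_iff,
        Set.mem_singleton_iff, Set.mem_ofPred_eq, exists_prop]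
      constructor
      · exact fun hs => ⟨_, _, _, hs, rfl, rfl, rfl⟩
      · rintro ⟨G, a, b, hs, rfl, rfl, rfl⟩
        exact hs
    rw [e]
    refine MeasurableSet.iUnion fun G => MeasurableSet.iUnion fun a => MeasurableSet.iUnion fun b =>
      MeasurableSet.iUnion fun _ => MeasurableSet.inter ?_ ?_
    · exact h.past.mono n.le_succ _ (ih trivial)
    · exact h.comap_le_past n _ (measurableSet_select n a b)

lemma stronglyMeasurable_comp (h : IsUniformSelection μ A B) {n : ℕ}
    (f : SimpleGraph (Fin (n + 1)) → ℝ) :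
    StronglyMeasurable[h.past n] fun ω => f (randomGraph A B n ω) :=
  Measurable.stronglyMeasurable fun s _ =>
    h.measurable_randomGraph n (show MeasurableSet[⊤] (f ⁻¹' s) from trivial)

lemma stronglyMeasurable_step (h : IsUniformSelection μ A B) {n : ℕ}
    (f : SimpleGraph (Fin (n + 1)) → Fin (n + 1) → Fin (n + 1) → ℝ) :
    StronglyMeasurable[h.past (n + 1)] fun ω => f (randomGraph A B n ω) (A n ω) (B n ω) := by
  classical
  have e : (fun ω => f (randomGraph A B n ω) (A n ω) (B n ω)) = fun ω => ∑ a, ∑ b,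
      {ω | A n ω = a ∧ B n ω = b}.indicator (fun ω => f (randomGraph A B n ω) a b) ω := by
    ext ω
    rw [Finset.sum_eq_single (A n ω), Finset.sum_eq_single (B n ω)]
    · simp
    · intro b _ hb; simp [Ne.symm hb]
    · simp
    · intro a _ ha; simp [Ne.symm ha]
    · simp
  rw [e]
  refine Finset.stronglyMeasurable_fun_sum _ fun a _ =>
    Finset.stronglyMeasurable_fun_sum _ fun b _ => StronglyMeasurable.indicator ?_ ?_
  · exact (h.stronglyMeasurable_comp fun G => f G a b).mono (h.past.mono n.le_succ)
  · exact h.comap_le_past n _ (measurableSet_select n a b)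

/-- For fixed `n` there are finitely many graphs and choices, so every functional of a step is
bounded, hence integrable. -/
lemma exists_bound {n : ℕ} (f : SimpleGraph (Fin (n + 1)) → Fin (n + 1) → Fin (n + 1) → ℝ) :
    ∃ K, ∀ G a b, |f G a b| ≤ K := by
  obtain ⟨K, hK⟩ := (Set.finite_range fun p : SimpleGraph (Fin (n + 1)) × Fin (n + 1) × Fin (n + 1) =>
    |f p.1 p.2.1 p.2.2|).bddAbove
  exact ⟨K, fun G a b => hK ⟨(G, a, b), rfl⟩⟩

lemma indep_past (h : IsUniformSelection μ A B) (n : ℕ) :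
    Indep (MeasurableSpace.comap (fun ω => (A n ω, B n ω)) inferInstance) (h.past n) μ := by
  have h1 := indep_iSup_of_disjoint (fun k => (h.measurable_pair k).comap_le)
    h.indep_steps.iIndep (S := {n}) (T := Set.Iio n) (by simp)
  rw [iSup_singleton] at h1
  exact h1

lemma measureReal_select (h : IsUniformSelection μ A B) (n : ℕ) (a b : Fin (n + 1)) :
    μ.real {ω | A n ω = a ∧ B n ω = b} = 1 / ((n : ℝ) + 1) ^ 2 := by
  have h1 := (h.indep_pair n).measure_inter_preimage_eq_mul {a} {b}
    (measurableSet_singleton _) (measurableSet_singleton _)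
  rw [h.uniform_fst, h.uniform_snd] at h1
  have e : {ω | A n ω = a ∧ B n ω = b} = A n ⁻¹' {a} ∩ B n ⁻¹' {b} := by ext; simp
  rw [measureReal_def, e, h1, ENNReal.toReal_mul, ENNReal.toReal_inv]
  rw [ENNReal.toReal_add (by simp) (by simp)]
  simp [sq]

variable [IsProbabilityMeasure μ]

lemma integrable_step (h : IsUniformSelection μ A B) {n : ℕ}
    (f : SimpleGraph (Fin (n + 1)) → Fin (n + 1) → Fin (n + 1) → ℝ) :
    Integrable (fun ω => f (randomGraph A B n ω) (A n ω) (B n ω)) μ := by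
  obtain ⟨K, hK⟩ := exists_bound f
  exact Integrable.of_bound ((h.stronglyMeasurable_step f).mono (h.past.le _)).aestronglyMeasurable
    K (ae_of_all _ fun ω => hK _ _ _)

lemma integrable_comp (h : IsUniformSelection μ A B) {n : ℕ}
    (f : SimpleGraph (Fin (n + 1)) → ℝ) :
    Integrable (fun ω => f (randomGraph A B n ω)) μ :=
  h.integrable_step fun G _ _ => f G

/-- Given the past, the two choices are uniform. -/
lemma condExp_step (h : IsUniformSelection μ A B) {n : ℕ}
    (f : SimpleGraph (Fin (n + 1)) → Fin (n + 1) → Fin (n + 1) → ℝ) :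
    μ[fun ω => f (randomGraph A B n ω) (A n ω) (B n ω) | h.past n] =ᵐ[μ]
      fun ω => selectAvg (f (randomGraph A B n ω)) := by
  classical
  have hle : MeasurableSpace.comap (fun ω => (A n ω, B n ω)) inferInstance ≤ mΩ :=
    (h.measurable_pair n).comap_le
  set I : Fin (n + 1) → Fin (n + 1) → Ω → ℝ := fun a b =>
    {ω | A n ω = a ∧ B n ω = b}.indicator fun _ => (1 : ℝ) with hI
  have hIm : ∀ a b, StronglyMeasurable[MeasurableSpace.comap (fun ω => (A n ω, B n ω)) inferInstance]
      (I a b) := fun a b => stronglyMeasurable_const.indicator (measurableSet_select n a b)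
  have hIi : ∀ a b, Integrable (I a b) μ := fun a b =>
    (integrable_const (1 : ℝ)).indicator (hle _ (measurableSet_select n a b))
  have hterm : ∀ a b, μ[(fun ω => f (randomGraph A B n ω) a b) * I a b | h.past n] =ᵐ[μ]
      fun ω => f (randomGraph A B n ω) a b * (1 / ((n : ℝ) + 1) ^ 2) := by
    intro a b
    have hint : Integrable ((fun ω => f (randomGraph A B n ω) a b) * I a b) μ := by
      have := h.integrable_step fun G a' b' => f G a b * if a' = a ∧ b' = b then 1 else 0
      exact this.congr (ae_of_all _ fun ω => by simp [hI, Set.indicator_apply])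
    filter_upwards [condExp_mul_of_stronglyMeasurable_left
      (h.stronglyMeasurable_comp fun G => f G a b) hint (hIi a b),
      condExp_indep_eq hle (h.past.le n) (hIm a b) (h.indep_past n)] with ω h1 h2
    rw [h1, Pi.mul_apply, h2, ← h.measureReal_select n a b,
      integral_indicator_const _ (hle _ (measurableSet_select n a b))]
    simp
  -- Splitting by the values of the choices: each term is a factor known from the past times an
  -- indicator independent of it.
  have e : (fun ω => f (randomGraph A B n ω) (A n ω) (B n ω)) =
      ∑ p : Fin (n + 1) × Fin (n + 1), (fun ω => f (randomGraph A B n ω) p.1 p.2) * I p.1 p.2 := by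
    ext ω
    rw [Finset.sum_apply, Finset.sum_eq_single (A n ω, B n ω)]
    · simp [hI]
    · rintro ⟨a, b⟩ _ hab
      simp only [ne_eq, Prod.mk.injEq, not_and] at hab
      have : ω ∉ {ω | A n ω = a ∧ B n ω = b} := fun hh => hab hh.1.symm hh.2.symm
      simp [hI, Set.indicator_of_notMem this]
    · simp
  rw [e]
  have hint : ∀ p ∈ (Finset.univ : Finset (Fin (n + 1) × Fin (n + 1))),
      Integrable ((fun ω => f (randomGraph A B n ω) p.1 p.2) * I p.1 p.2) μ := fun p _ =>
    (h.integrable_step fun G a' b' => f G p.1 p.2 * if a' = p.1 ∧ b' = p.2 then 1 else 0).congr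
      (ae_of_all _ fun ω => by simp [hI, Set.indicator_apply])
  filter_upwards [condExp_finsetSum hint (h.past n),
    ae_all_iff.2 fun p : Fin (n + 1) × Fin (n + 1) => hterm p.1 p.2] with ω h1 h2
  rw [h1, Finset.sum_apply, Finset.sum_congr rfl fun p _ => h2 p, Fintype.sum_prod_type,
    selectAvg, Finset.sum_div]
  simp only [Finset.sum_div, mul_one_div]

lemma integral_step (h : IsUniformSelection μ A B) {n : ℕ}
    (f : SimpleGraph (Fin (n + 1)) → Fin (n + 1) → Fin (n + 1) → ℝ) :
    ∫ ω, f (randomGraph A B n ω) (A n ω) (B n ω) ∂μ =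
      ∫ ω, selectAvg (f (randomGraph A B n ω)) ∂μ := by
  rw [← integral_condExp (h.past.le n), integral_congr_ae (h.condExp_step f)]

lemma integral_degreeSum (h : IsUniformSelection μ A B) (n : ℕ) :
    ∫ ω, degreeSum (randomGraph A B n ω) ∂μ = 2 * n := by
  induction n with
  | zero =>
    have : ∀ ω, degreeSum (randomGraph A B 0 ω) = 0 := fun ω => by
      simp [randomGraph, graphV1, degreeSum_bot]
    simp [this]
  | succ n ih =>
    have h1 := h.integral_step (n := n) fun G a b => degreeSum (stepV1 G a b)
    simp only [selectAvg_degreeSum] at h1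
    simp_rw [randomGraph_succ]
    rw [h1, integral_add (h.integrable_comp fun G => degreeSum G) (integrable_const _), ih]
    simp; ring

/-- The constant is `19 = 7 + 12`, where `12` bounds `6 * (2 * n) / (n + 1)`. -/
lemma integral_degreeSqSum_le (h : IsUniformSelection μ A B) (n : ℕ) :
    ∫ ω, degreeSqSum (randomGraph A B n ω) ∂μ ≤ 19 * (n + 1) := by
  induction n with
  | zero =>
    have : ∀ ω, degreeSqSum (randomGraph A B 0 ω) = 1 := fun ω => by
      simp [randomGraph, graphV1, degreeSqSum_bot]
    simp [this]
  | succ n ih =>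
    have h1 := h.integral_step (n := n) fun G a b => degreeSqSum (stepV1 G a b)
    simp_rw [randomGraph_succ]
    have i1 := h.integrable_comp (n := n) fun G => degreeSqSum G
    have i2 := h.integrable_comp (n := n) fun G => 6 * degreeSum G / (n + 1)
    rw [h1]
    calc ∫ ω, selectAvg (fun a b => degreeSqSum (stepV1 (randomGraph A B n ω) a b)) ∂μ
        ≤ ∫ ω, (degreeSqSum (randomGraph A B n ω) +
            6 * degreeSum (randomGraph A B n ω) / (n + 1) + 7) ∂μ :=
          integral_mono (h.integrable_comp fun G => selectAvg fun a b => degreeSqSum (stepV1 G a b))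
            ((i1.add i2).add (integrable_const 7)) fun ω => selectAvg_degreeSqSum_le _
      _ = ∫ ω, degreeSqSum (randomGraph A B n ω) ∂μ + 6 * (2 * n) / (n + 1) + 7 := by
          have i3 : Integrable (fun ω => degreeSqSum (randomGraph A B n ω) +
            6 * degreeSum (randomGraph A B n ω) / (n + 1)) μ := i1.add i2
          rw [integral_add i3 (integrable_const 7), integral_add i1 i2, integral_div,
            integral_const_mul, h.integral_degreeSum]
          simp
      _ ≤ 19 * (((n + 1 : ℕ) : ℝ) + 1) := by
          have : 6 * (2 * (n : ℝ)) / (n + 1) ≤ 12 := by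
            rw [div_le_iff₀ (by positivity)]; linarith
          push_cast
          linarith

/-- Almost surely, the density of open triplets vanishes. -/
lemma ae_tendsto_openCount (h : IsUniformSelection μ A B) : ∀ᵐ ω ∂μ,
    Tendsto (fun n : ℕ => openCount (randomGraph A B n ω) / (n + 1)) atTop (𝓝 0) := by
  have hQ : ∀ n : ℕ, ∫ ω, 2 * degreeSqSum (randomGraph A B n ω) / ((n : ℝ) + 1) ^ 2 ∂μ ≤
      38 * (1 / ((n : ℝ) + 1)) := by
    intro n
    rw [integral_div, integral_const_mul, div_le_iff₀ (by positivity)]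
    have := h.integral_degreeSqSum_le n
    calc _ ≤ 2 * (19 * ((n : ℝ) + 1)) := by gcongr
      _ = _ := by field_simp; norm_num
  have hstep : ∀ n : ℕ, ∫ ω, openCount (randomGraph A B (n + 1) ω) ∂μ ≤
      ∫ ω, openCount (randomGraph A B n ω) ∂μ + 38 * (1 / ((n : ℝ) + 1)) := by
    intro n
    have h1 := h.integral_step (n := n) fun G a b => openCount (stepV1 G a b)
    have i1 := h.integrable_comp (n := n) fun G => openCount G
    have i2 := h.integrable_comp (n := n) fun G => 2 * degreeSqSum G / ((n : ℝ) + 1) ^ 2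
    simp_rw [randomGraph_succ]
    rw [h1]
    calc _ ≤ ∫ ω, (openCount (randomGraph A B n ω) +
            2 * degreeSqSum (randomGraph A B n ω) / ((n : ℝ) + 1) ^ 2) ∂μ :=
          integral_mono (h.integrable_comp fun G => selectAvg fun a b => openCount (stepV1 G a b))
            (i1.add i2) fun ω => selectAvg_openCount_le _
      _ ≤ _ := by rw [integral_add i1 i2]; linarith [hQ n]
  have hsum : ∀ n : ℕ, ∫ ω, openCount (randomGraph A B n ω) ∂μ ≤
      38 * ∑ k ∈ Finset.range n, 1 / ((k : ℝ) + 1) := by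
    intro n
    induction n with
    | zero =>
      have : ∀ ω, openCount (randomGraph A B 0 ω) = 0 := fun ω => by
        simp [openCount, openInd, randomGraph, graphV1]
      simp [this]
    | succ n ih => rw [Finset.sum_range_succ, mul_add]; linarith [hstep n]
  -- The harmonic sum divided by `n + 1` is essentially a Cesàro mean of a null sequence.
  have hlim : Tendsto (fun n : ℕ => 38 * ∑ k ∈ Finset.range n, 1 / ((k : ℝ) + 1) / ((n : ℝ) + 1))
      atTop (𝓝 0) := by
    have h1 : Tendsto (fun k : ℕ => 1 / ((k : ℝ) + 1)) atTop (𝓝 0) :=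
      tendsto_one_div_add_atTop_nhds_zero_nat
    have h2 := (h1.cesaro.mul (tendsto_natCast_div_add_atTop (1 : ℝ))).const_mul 38
    simp only [zero_mul, mul_zero] at h2
    refine h2.congr fun n => ?_
    rw [← Finset.sum_div]
    rcases Nat.eq_zero_or_pos n with rfl | hn
    · simp
    · have : (0 : ℝ) < n := by exact_mod_cast hn
      field_simp
  refine ae_tendsto_zero_of_almost_supermartingale (F := h.past)
    (Y := fun (n : ℕ) ω => openCount (randomGraph A B n ω) / ((n : ℝ) + 1))
    (e := fun (n : ℕ) ω => 2 * degreeSqSum (randomGraph A B n ω) / ((n : ℝ) + 1) ^ 2 / ((n : ℝ) + 2))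
    (fun n => h.stronglyMeasurable_comp fun G => openCount G / ((n : ℝ) + 1))
    (fun n => h.stronglyMeasurable_comp fun G =>
      2 * degreeSqSum G / ((n : ℝ) + 1) ^ 2 / ((n : ℝ) + 2))
    (fun n => h.integrable_comp fun G => openCount G / ((n : ℝ) + 1))
    (fun n => h.integrable_comp fun G => 2 * degreeSqSum G / ((n : ℝ) + 1) ^ 2 / ((n : ℝ) + 2))
    (fun n ω => div_nonneg (openCount_nonneg _) (by positivity))
    (fun n ω => by have := degreeSqSum_nonneg (randomGraph A B n ω); positivity) ?_ ?_ ?_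
  · intro n
    have h1 := h.condExp_step (n := n) fun G a b => openCount (stepV1 G a b) / (((n + 1 : ℕ) : ℝ) + 1)
    filter_upwards [h1] with ω h1
    have e1 : (fun ω => openCount (randomGraph A B (n + 1) ω) / (((n + 1 : ℕ) : ℝ) + 1)) =
      fun ω => openCount (stepV1 (randomGraph A B n ω) (A n ω) (B n ω)) / (((n + 1 : ℕ) : ℝ) + 1) := rfl
    rw [e1, h1]
    have h2 := selectAvg_openCount_le (randomGraph A B n ω)
    have h3 : selectAvg (fun a b => openCount (stepV1 (randomGraph A B n ω) a b) /
        (((n + 1 : ℕ) : ℝ) + 1)) = selectAvg (fun a b => openCount (stepV1 (randomGraph A B n ω) a b)) /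
        (((n + 1 : ℕ) : ℝ) + 1) := by
      simp only [selectAvg, ← Finset.sum_div]
      ring
    have h4 : openCount (randomGraph A B n ω) / ((n : ℝ) + 2) ≤
        openCount (randomGraph A B n ω) / ((n : ℝ) + 1) := by
      have := openCount_nonneg (randomGraph A B n ω)
      gcongr; norm_num
    have h5 : ((n + 1 : ℕ) : ℝ) + 1 = (n : ℝ) + 2 := by push_cast; ring
    rw [h3, h5, Pi.add_apply]
    calc _ ≤ (openCount (randomGraph A B n ω) +
          2 * degreeSqSum (randomGraph A B n ω) / ((n : ℝ) + 1) ^ 2) / ((n : ℝ) + 2) := by gcongr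
      _ ≤ _ := by rw [add_div]; gcongr
  · have h1 : Summable fun n : ℕ => 38 * (1 / ((n : ℝ) + 1) ^ 2) :=
      (((summable_nat_add_iff 1).2 (Real.summable_one_div_nat_pow.2 one_lt_two)).congr
        fun n => by push_cast; rfl).mul_left 38
    refine Summable.of_nonneg_of_le (fun n => integral_nonneg fun ω => ?_) (fun n => ?_) h1
    · have := degreeSqSum_nonneg (randomGraph A B n ω); simp only [Pi.zero_apply]; positivity
    · rw [integral_div]
      calc _ ≤ 38 * (1 / ((n : ℝ) + 1)) / ((n : ℝ) + 1) :=
            div_le_div₀ (by positivity) (hQ n) (by positivity) (by linarith)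
        _ = _ := by field_simp
  · refine squeeze_zero (fun n => integral_nonneg fun ω =>
      div_nonneg (openCount_nonneg _) (by positivity)) (fun n => ?_) hlim
    rw [integral_div, ← Finset.sum_div, ← mul_div_assoc]
    gcongr
    exact hsum n

end IsUniformSelection

end Selection

lemma selectAvg_sub_sq_le {n : ℕ} (f : Fin (n + 1) → Fin (n + 1) → ℝ) :
    selectAvg (fun a b => (f a b - selectAvg f) ^ 2) ≤ selectAvg fun a b => f a b ^ 2 := by
  have hn : (0 : ℝ) < ((n : ℝ) + 1) ^ 2 := by positivity
  have h1 : ∑ a, ∑ b, f a b = selectAvg f * ((n : ℝ) + 1) ^ 2 := by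
    unfold selectAvg; field_simp
  generalize selectAvg f = m at h1 ⊢
  unfold selectAvg
  gcongr ?_ / _
  have e : ∑ a, ∑ b, (f a b - m) ^ 2 =
      ∑ a, ∑ b, f a b ^ 2 - 2 * m * ∑ a, ∑ b, f a b + m ^ 2 * ((n : ℝ) + 1) ^ 2 := by
    have : ∀ a b, (f a b - m) ^ 2 = f a b ^ 2 - 2 * m * f a b + m ^ 2 := fun a b => by ring
    simp only [this, Finset.sum_add_distrib, Finset.sum_sub_distrib, ← Finset.mul_sum]
    simp; ring
  rw [e, h1]
  nlinarith [mul_nonneg (sq_nonneg m) hn.le]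

/-! ### Almost sure limits. -/

section Limits

variable {Ω : Type*} {A B : (n : ℕ) → Ω → Fin (n + 1)} [mΩ : MeasurableSpace Ω] {μ : Measure Ω}
  [IsProbabilityMeasure μ]

namespace IsUniformSelection

/-- The martingale part of the first order change of the degree counts converges. -/
lemma ae_exists_tendsto_noise (h : IsUniformSelection μ A B) (d : ℕ) : ∀ᵐ ω ∂μ, ∃ l,
    Tendsto (fun n => ∑ k ∈ Finset.range n, (linearDrift (randomGraph A B k ω) d (A k ω) (B k ω) -
      selectAvg (linearDrift (randomGraph A B k ω) d)) / ((k : ℝ) + 2)) atTop (𝓝 l) := by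
  set f : (k : ℕ) → SimpleGraph (Fin (k + 1)) → Fin (k + 1) → Fin (k + 1) → ℝ := fun k G a b =>
    (linearDrift G d a b - selectAvg (linearDrift G d)) / ((k : ℝ) + 2) with hf
  choose K hK using fun k => exists_bound (f k)
  have hzero : ∀ k G, selectAvg (f k G) = 0 := by
    intro k G
    have h1 : ∑ a, ∑ b, linearDrift G d a b =
        selectAvg (linearDrift G d) * ((k : ℝ) + 1) ^ 2 := by
      have : ((k : ℝ) + 1) ^ 2 ≠ 0 := by positivity
      rw [selectAvg, div_mul_cancel₀ _ this]
    have h2 : ∑ a, ∑ b, f k G a b = 0 := by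
      simp only [hf, ← Finset.sum_div, Finset.sum_sub_distrib, h1]
      simp; left; ring
    rw [selectAvg, h2, zero_div]
  -- Here `190 = 10 * 19` combines the bound on the squared drift with that on the expected
  -- `degreeSqSum`. Only the linearised change enters the martingale; the remainder is summed
  -- absolutely.
  have hvar : ∀ k : ℕ, ∫ ω, f k (randomGraph A B k ω) (A k ω) (B k ω) ^ 2 ∂μ ≤
      190 * (1 / ((k : ℝ) + 1) ^ 2) := by
    intro k
    have h1 := h.integral_step (n := k) fun G a b => f k G a b ^ 2
    rw [h1]
    have i1 := h.integrable_comp (n := k) fun G => 10 * degreeSqSum G / (k + 1) / ((k : ℝ) + 2) ^ 2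
    calc _ ≤ ∫ ω, 10 * degreeSqSum (randomGraph A B k ω) / (k + 1) / ((k : ℝ) + 2) ^ 2 ∂μ := by
          refine integral_mono (h.integrable_comp fun G => selectAvg fun a b => f k G a b ^ 2) i1
            fun ω => ?_
          have e : selectAvg (fun a b => f k (randomGraph A B k ω) a b ^ 2) =
              selectAvg (fun a b => (linearDrift (randomGraph A B k ω) d a b -
                selectAvg (linearDrift (randomGraph A B k ω) d)) ^ 2) / ((k : ℝ) + 2) ^ 2 := by
            simp only [hf, div_pow]
            simp only [selectAvg, ← Finset.sum_div]
            ring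
          dsimp only
          rw [e]
          gcongr
          exact (selectAvg_sub_sq_le _).trans (selectAvg_linearDrift_sq_le _ _)
      _ = 10 * (∫ ω, degreeSqSum (randomGraph A B k ω) ∂μ) / (k + 1) / ((k : ℝ) + 2) ^ 2 := by
          rw [integral_div, integral_div, integral_const_mul]
      _ ≤ 10 * (19 * ((k : ℝ) + 1)) / (k + 1) / ((k : ℝ) + 1) ^ 2 := by
          have h2 := h.integral_degreeSqSum_le k
          have h3 : (0 : ℝ) ≤ 10 * (19 * ((k : ℝ) + 1)) / (k + 1) := by positivity
          refine div_le_div₀ h3 ?_ (by positivity) (by gcongr; norm_num)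
          gcongr
      _ = _ := by field_simp; norm_num
  have hs : Summable fun k : ℕ => 190 * (1 / ((k : ℝ) + 1) ^ 2) :=
    (((summable_nat_add_iff 1).2 (Real.summable_one_div_nat_pow.2 one_lt_two)).congr
      fun n => by push_cast; rfl).mul_left 190
  refine ae_exists_tendsto_sum_martingaleDiff (F := h.past) (K := K)
    (C := ∑' k : ℕ, 190 * (1 / ((k : ℝ) + 1) ^ 2))
    (ζ := fun k ω => f k (randomGraph A B k ω) (A k ω) (B k ω))
    (fun k => h.stronglyMeasurable_step (f k)) (fun k ω => hK k _ _ _) (fun k => ?_) fun n => ?_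
  · filter_upwards [h.condExp_step (f k)] with ω hω
    rw [hω, hzero]; rfl
  · exact (Finset.sum_le_sum fun k _ => hvar k).trans
      (hs.sum_le_tsum _ fun k _ => by positivity)

/-- The deviation of the degree counts from the first order approximation is summable. -/
lemma ae_summable_common (h : IsUniformSelection μ A B) : ∀ᵐ ω ∂μ, Summable fun n : ℕ =>
    4 * (∑ v, clInd (randomGraph A B n ω) v (A n ω) * clInd (randomGraph A B n ω) v (B n ω)) /
      ((n : ℝ) + 2) := by
  refine ae_summable_of_summable_integral
    (fun n => h.integrable_step fun G a b => 4 * (∑ v, clInd G v a * clInd G v b) / ((n : ℝ) + 2))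
    (fun n ω => ?_) ?_
  · have := Finset.sum_nonneg fun v (_ : v ∈ Finset.univ) => mul_nonneg
      (clInd_nonneg (randomGraph A B n ω) v (A n ω)) (clInd_nonneg (randomGraph A B n ω) v (B n ω))
    positivity
  have hs : Summable fun k : ℕ => 76 * (1 / ((k : ℝ) + 1) ^ 2) :=
    (((summable_nat_add_iff 1).2 (Real.summable_one_div_nat_pow.2 one_lt_two)).congr
      fun n => by push_cast; rfl).mul_left 76
  refine Summable.of_nonneg_of_le (fun n => integral_nonneg fun ω => ?_) (fun n => ?_) hs
  · have := Finset.sum_nonneg fun v (_ : v ∈ Finset.univ) => mul_nonneg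
      (clInd_nonneg (randomGraph A B n ω) v (A n ω)) (clInd_nonneg (randomGraph A B n ω) v (B n ω))
    simp only [Pi.zero_apply]
    positivity
  · have h1 := h.integral_step (n := n) fun G a b => 4 * ∑ v, clInd G v a * clInd G v b
    simp only [selectAvg_common_eq] at h1
    rw [integral_div, h1, integral_div, integral_const_mul]
    have h2 := h.integral_degreeSqSum_le n
    calc _ ≤ 4 * (19 * ((n : ℝ) + 1)) / ((n : ℝ) + 1) ^ 2 / ((n : ℝ) + 1) :=
          div_le_div₀ (by positivity) (by gcongr) (by positivity) (by linarith)
      _ = _ := by field_simp; norm_num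

lemma degreeCount_le {n : ℕ} (G : SimpleGraph (Fin (n + 1))) (d : ℕ) : degreeCount G d ≤ n + 1 := by
  unfold degreeCount
  exact (Finset.card_le_univ _).trans_eq (Fintype.card_fin _)

/-- Almost surely, the degree distribution converges. -/
lemma ae_tendsto_degreeCount (h : IsUniformSelection μ A B) : ∀ᵐ ω ∂μ, ∀ d,
    Tendsto (fun n : ℕ => (degreeCount (randomGraph A B n ω) d : ℝ) / ((n : ℝ) + 1)) atTop
      (𝓝 (limitDegree d)) := by
  filter_upwards [ae_all_iff.2 h.ae_exists_tendsto_noise, h.ae_summable_common] with ω h1 h2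
  set G := fun n => randomGraph A B n ω with hG
  set x : ℕ → ℕ → ℝ := fun d n => (degreeCount (G n) d : ℝ) / ((n : ℝ) + 1) with hx
  set ξ : ℕ → ℕ → ℝ := fun d n => linearDrift (G n) d (A n ω) (B n ω) -
    selectAvg (linearDrift (G n) d) with hξ
  set r : ℕ → ℕ → ℝ := fun d n => (degreeCount (G (n + 1)) d : ℝ) - degreeCount (G n) d -
    linearDrift (G n) d (A n ω) (B n ω) with hr
  have hrs : ∀ d, Summable fun n : ℕ => r d n / ((n : ℝ) + 2) := by
    intro d
    refine Summable.of_norm_bounded h2 fun n => ?_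
    rw [Real.norm_eq_abs, abs_div, abs_of_pos (by positivity : (0 : ℝ) < (n : ℝ) + 2)]
    gcongr
    exact abs_degreeCount_stepV1_sub_le (G n) (A n ω) (B n ω) d
  -- The drift has `2d + 2`; the additional `1` in `2d + 3` comes from renormalising by `n + 2`
  -- instead of `n + 1`.
  have hrec : ∀ d n : ℕ, x d (n + 1) = x d n + (((d : ℝ) + 1) *
      ((if d = 0 then 0 else x (d - 1) n) + x (d + 1) n) - (2 * d + 3) * x d n +
        if d = 0 then 1 else 0) / (n + 2) + (ξ d n / (n + 2) + r d n / (n + 2)) := by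
    intro d n
    have e1 : (degreeCount (G (n + 1)) d : ℝ) = degreeCount (G n) d + ξ d n + r d n +
        selectAvg (linearDrift (G n) d) := by simp only [hξ, hr]; ring
    rw [selectAvg_linearDrift] at e1
    have e2 : (if d = 0 then 0 else x (d - 1) n) =
        (if d = 0 then 0 else (degreeCount (G n) (d - 1) : ℝ)) / ((n : ℝ) + 1) := by
      split_ifs <;> simp [hx]
    rw [e2]
    simp only [hx]
    rw [e1]
    generalize (if d = 0 then 0 else (degreeCount (G n) (d - 1) : ℝ)) = p
    generalize (if d = 0 then (1 : ℝ) else 0) = q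
    have h3 : (n : ℝ) + 1 ≠ 0 := by positivity
    have h4 : (n : ℝ) + 2 ≠ 0 := by positivity
    have h5 : (((n + 1 : ℕ) : ℝ) + 1) = (n : ℝ) + 2 := by push_cast; ring
    rw [h5]
    field_simp
    ring
  have hx01 : ∀ d n, 0 ≤ x d n ∧ x d n ≤ 1 := fun d n => by
    refine ⟨by simp only [hx]; positivity, div_le_one_of_le₀ ?_ (by positivity)⟩
    exact_mod_cast degreeCount_le (G n) d
  intro d
  -- Subtracting the balance equation of `limitDegree` removes the source term at `d = 0`; the bound
  -- `1` holds because both terms lie in `[0, 1]`.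
  have key := tendsto_zero_of_coupled_recursion (y := fun d n => x d n - limitDegree d)
    (e := fun d n => ξ d n / (n + 2) + r d n / (n + 2)) (K := 1) (fun d n => ?_) (fun d => ?_)
    (fun d n => ?_) d
  · have := key.add_const (limitDegree d)
    simpa only [sub_add_cancel, zero_add] using this
  · have := hx01 d n
    have := limitDegree_pos d
    have := limitDegree_le_one d
    rw [abs_le]; constructor <;> linarith
  · obtain ⟨l, hl⟩ := h1 d
    refine ⟨l + ∑' n, r d n / ((n : ℝ) + 2), ?_⟩
    simp only [Finset.sum_add_distrib]
    exact hl.add (hrs d).hasSum.tendsto_sum_nat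
  · have hb := limitDegree_balance d
    have e3 : (if d = 0 then 0 else x (d - 1) n - limitDegree (d - 1)) =
        (if d = 0 then 0 else x (d - 1) n) - if d = 0 then 0 else limitDegree (d - 1) := by
      split_ifs <;> simp
    rw [hrec, e3]
    have e4 : ((d : ℝ) + 1) * ((if d = 0 then 0 else x (d - 1) n) + x (d + 1) n) -
        (2 * d + 3) * x d n + (if d = 0 then 1 else 0) =
        ((d : ℝ) + 1) * (((if d = 0 then 0 else x (d - 1) n) -
          if d = 0 then 0 else limitDegree (d - 1)) + (x (d + 1) n - limitDegree (d + 1))) -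
            (2 * d + 3) * (x d n - limitDegree d) := by linear_combination -hb
    rw [e4]
    ring

lemma ae_tendsto_globalClustering (h : IsUniformSelection μ A B) : ∀ᵐ ω ∂μ,
    Tendsto (fun n : ℕ => globalClustering (randomGraph A B n ω)) atTop (𝓝 1) := by
  filter_upwards [h.ae_tendsto_degreeCount, h.ae_tendsto_openCount] with ω h1 h2
  have h3 := (h2.div (h1 2) (limitDegree_pos 2).ne').const_sub 1
  rw [zero_div, sub_zero] at h3
  refine tendsto_of_tendsto_of_tendsto_of_le_of_le' h3 tendsto_const_nhds ?_
    (Eventually.of_forall fun n => globalClustering_le_one _)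
  filter_upwards [(tendsto_order.1 (h1 2)).1 0 (limitDegree_pos 2)] with n hn
  have hpos : (0 : ℝ) < (n : ℝ) + 1 := by positivity
  have h4 : (0 : ℝ) < degreeCount (randomGraph A B n ω) 2 := by
    by_contra! hle
    exact absurd hn (not_lt.2 (div_nonpos_of_nonpos_of_nonneg hle hpos.le))
  have h5 := one_sub_le_globalClustering (randomGraph A B n ω) (by exact_mod_cast h4)
  simp only [Pi.div_apply]
  rwa [div_div_div_cancel_right₀ hpos.ne']

lemma ae_tendsto_averageClustering (h : IsUniformSelection μ A B) : ∀ᵐ ω ∂μ,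
    Tendsto (fun n : ℕ => averageClustering (randomGraph A B n ω)) atTop
      (𝓝 (1 - limitDegree 0 - limitDegree 1)) := by
  filter_upwards [h.ae_tendsto_degreeCount, h.ae_tendsto_openCount] with ω h1 h2
  have h3 : Tendsto (fun n : ℕ => averageClustering (randomGraph A B n ω) -
      (1 - (degreeCount (randomGraph A B n ω) 0 : ℝ) / ((n : ℝ) + 1) -
        (degreeCount (randomGraph A B n ω) 1 : ℝ) / ((n : ℝ) + 1))) atTop (𝓝 0) := by
    refine squeeze_zero_norm (fun n => ?_) h2
    have := abs_averageClustering_sub_le (randomGraph A B n ω)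
    rw [Fintype.card_fin] at this
    push_cast at this
    exact this
  have h4 := h3.add (((h1 0).const_sub 1).sub (h1 1))
  simpa only [sub_add_cancel, zero_add] using h4

end IsUniformSelection

end Limits

theorem theorem4 :
    ∃ c : ℕ → ℝ,
      (∀ d, 0 < c d) ∧
      c 0 = (1 + c 1) / 3 ∧
      (∀ d : ℕ, 1 ≤ d → c d = ((d : ℝ) + 1) / (2 * (d : ℝ) + 3) * (c (d - 1) + c (d + 1))) ∧
      ∀ {Ω : Type*} [MeasurableSpace Ω] (μ : Measure Ω) [IsProbabilityMeasure μ]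
        (A B : (n : ℕ) → Ω → Fin (n + 1)), IsUniformSelection μ A B →
        (∀ d : ℕ, ∀ᵐ ω ∂μ, Tendsto
          (fun n : ℕ =>
            (degreeCount (graphV1 (fun k => A k ω) (fun k => B k ω) n) d : ℝ) / ((n : ℝ) + 1))
          atTop (𝓝 (c d))) ∧
        (∀ᵐ ω ∂μ, Tendsto
          (fun n : ℕ => globalClustering (graphV1 (fun k => A k ω) (fun k => B k ω) n))
          atTop (𝓝 1)) ∧
        (∀ᵐ ω ∂μ, Tendsto
          (fun n : ℕ => averageClustering (graphV1 (fun k => A k ω) (fun k => B k ω) n))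
          atTop (𝓝 (1 - c 0 - c 1))) := by
  refine ⟨limitDegree, limitDegree_pos, ?_, fun d hd => ?_, fun μ _ A B h => ⟨fun d => ?_,
    h.ae_tendsto_globalClustering, h.ae_tendsto_averageClustering⟩⟩
  · linarith [limitDegree_zero]
  · obtain ⟨d, rfl⟩ := Nat.exists_eq_add_of_le' hd
    have h3 : (0 : ℝ) < 2 * ((d + 1 : ℕ) : ℝ) + 3 := by positivity
    rw [div_mul_eq_mul_div, eq_div_iff h3.ne', add_tsub_cancel_right]
    push_cast
    linear_combination limitDegree_succ d
  · filter_upwards [h.ae_tendsto_degreeCount] with ω hω using hω d
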